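/- \textbf{Setting.} Let $G=(V,E)$ be a finite simple undirected graph with $n$ vertices and maximum degree $\Delta=\Delta(G)$. $G$ is revealed vertex by vertex: an adversary fixes $G$ and an arrival order of its vertices in advance (oblivious adversary); when a vertex arrives, its edges to all previously arrived vertices are revealed, and a randomized \emph{online edge-coloring algorithm} must immediately and irrevocably assign a color to each of these edges, based only on its random bits, on the part of the graph revealed so far, and on the parameters known to it in advance. Here these parameters are the number $n$ and a number $\Delta'$ that is promised to satisfy $\Delta'\le\Delta$; the maximum degree $\Delta$ itself is not known. For real $k\ge 0$, a \emph{$k$-edge-coloring} is an assignment of colors to the edges that uses at most $k$ distinct colors in total and gives distinct colors to any two distinct edges sharing an endpoint. \textbf{Theorem.} There exist a randomized online edge-coloring algorithm $\mathcal A$ and a constant $c>0$ with the following property. Let $\Delta'=\Delta'(n)$ be any sequence of natural numbers with $\Delta'(n)=\omega(\log n)$, that is, $\log n/\Delta'(n)\to 0$ as $n\to\infty$. Then there is a sequence $\varepsilon(n)\to 0$ (depending only on the sequence $\Delta'$) such that for every $n$, every $n$-vertex graph $G$ with maximum degree $\Delta\ge\Delta'(n)$, and every arrival order of its vertices, the algorithm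 $\mathcal A$, given $n$ and $\Delta'(n)$ in advance, outputs a $(1.777+\varepsilon(n))\Delta$-edge-coloring of $G$ with probability at least $1-n^{-c}$. -/

import Mathlib

open MeasureTheory Filter Topology Asymptotics

namespace OnlineEdgeColoring

/-- The graph on the first `t + 1` arrived vertices (named `0, …, t` in order of arrival): what has
been revealed of `G` once its `t`-th vertex (counting from `0`) has arrived. -/
def revealed {V : Type*} {n : ℕ} (G : SimpleGraph V) (arrival : Fin n ≃ V) (t : Fin n) :
    SimpleGraph (Fin (t + 1)) :=
  G.comap fun i => arrival (Fin.castLE t.isLt i)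

/-- A randomized online edge-coloring algorithm under vertex arrivals. A random seed is drawn once,
independently of the input. When vertex `t` arrives, the algorithm sees only its seed and the graph
`H` revealed so far, on the vertices `0, …, t`; for each earlier vertex `i < t` it fixes the color
`color ω t H i`, which is then the irrevocable color of the edge between `i` and `t` if there is
one. (The colors given earlier are determined by the seed and the earlier revealed graphs, which are
induced subgraphs of `H`, so letting `color` depend on them too would change nothing.) -/
structure Algorithm where
  /-- The set of random seeds. -/
  Seed : Type
  /-- The events on the set of seeds. -/
  mSeed : MeasurableSpace Seed
  /-- The distribution of the seed. -/
  law : Measure Seed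
  /-- The distribution of the seed is a probability measure. -/
  isProb : IsProbabilityMeasure law
  /-- The color given, upon arrival of vertex `t`, to the edge between `t` and `i < t`. -/
  color : Seed → (t : ℕ) → SimpleGraph (Fin (t + 1)) → Fin t → ℕ
  /-- Every color is a random variable. -/
  measurable_color : ∀ t H i, Measurable fun ω => color ω t H i

attribute [instance] Algorithm.mSeed Algorithm.isProb

namespace Algorithm

/-- The color given to the pair of the `i`-th and the `j`-th arriving vertex, decided when the later
one of the two arrives (`0`, never used, if `i = j`). -/
def pairColor (A : Algorithm) (ω : A.Seed) {V : Type*} {n : ℕ} (G : SimpleGraph V)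
    (arrival : Fin n ≃ V) (i j : Fin n) : ℕ :=
  if h : i < j then A.color ω j (revealed G arrival j) ⟨i, h⟩
  else if h : j < i then A.color ω i (revealed G arrival i) ⟨j, h⟩
  else 0

theorem pairColor_comm (A : Algorithm) (ω : A.Seed) {V : Type*} {n : ℕ} (G : SimpleGraph V)
    (arrival : Fin n ≃ V) (i j : Fin n) :
    A.pairColor ω G arrival i j = A.pairColor ω G arrival j i := by
  rcases lt_trichotomy i j with h | h | h
  · simp [pairColor, h, h.not_gt]
  · rw [h]
  · simp [pairColor, h, h.not_gt]

/-- The coloring of all edges of `G` that the algorithm outputs with seed `ω` when the vertices of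
`G` arrive in the order `arrival 0, arrival 1, …`. -/
def output (A : Algorithm) (ω : A.Seed) {V : Type*} {n : ℕ} (G : SimpleGraph V)
    (arrival : Fin n ≃ V) : G.EdgeLabeling ℕ := fun e =>
  Sym2.lift ⟨fun u v => A.pairColor ω G arrival (arrival.symm u) (arrival.symm v),
    fun _ _ => A.pairColor_comm ω G arrival _ _⟩ (e : Sym2 V)

end Algorithm

/-- The labeling `C` of the edges of `G` is a proper edge coloring (distinct edges that share an
endpoint have distinct colors) which uses at most `k` colors. -/
def IsEdgeColoringWith {V : Type*} {G : SimpleGraph V} (C : G.EdgeLabeling ℕ) (k : ℝ) : Prop :=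
  (∀ e f : G.edgeSet, e ≠ f → (∃ v, v ∈ (e : Sym2 V) ∧ v ∈ (f : Sym2 V)) → C e ≠ C f) ∧
    ((Set.range C).ncard : ℝ) ≤ k

end OnlineEdgeColoring

/-! Since Δ is unknown, the palette must grow with the largest degree `D` seen so far (at least Δ');
it has about 1.776 `D` colors. A deterministic online fractional coloring is built first, and then
rounded at random.

Fractional coloring. When `v` arrives, each edge to an earlier neighbor `u` spreads mass 1 over the
palette, looking only at the loads at `u`. Two aims compete: at `u` the mass should go to lightly
loaded colors; at `v`, whose edges are spread without coordination, no small set of colors should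
get much. The concave function `profile` caps the mass of a set of colors in terms of its size.
Minimizing the sum of squares of the new loads over the resulting base polytope makes every sublevel
set of the loads tight (`exists_fair_point`), which is as fair as the cap allows. The invariant
`IsBalanced` bounds, for thirteen thresholds, the total load above the threshold by a slope times
the degree of the vertex. It does not mention `D`, so it survives the growth of the palette. The
last slope is 0, so no color ever has load above 0.995 at a vertex.

Rounding. Edges are processed one at a time. Let Z v c be 0 if `c` is used at `v`, and otherwise the
inverse of the product of the probabilities with which it has survived so far. An edge uv with
fractional vector x gets color c with probability proportional to x c * Z u c * Z v c. Then Z is a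
martingale, and so are the total weight of each future edge (initially 1) and, for each v and c, the
sum of x c * Z w c over the edges vw, frozen once processed (initially at most 0.995). While the
former stay above 1 - 1/800 and the latter below 1 - 3/800, Z is at most 400
(`IsConsistent.isRegular`). Hence jumps are O(1/D), and exponential supermartingales with a
quadratic compensator (`sum_mul_exp_le_one`) keep these quantities in their ranges except with
probability exp(-Ω(D)). The argument is not circular because the process is stopped at the first
failure (`risk`). As Δ' = ω(log n), a union bound over all vertex-color pairs and all edges
suffices. -/

namespace OnlineEdgeColoring

/-! ### Fair points in the base polytope of a submodular function of the cardinality -/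

section FairPoint

variable {ι : Type*}

/-- The base polytope of the set function `A ↦ f #A`. -/
def basePolytope (ι : Type*) [Fintype ι] (f : ℕ → ℝ) : Set (ι → ℝ) :=
  {x | (∀ i, 0 ≤ x i) ∧ (∀ A : Finset ι, ∑ i ∈ A, x i ≤ f A.card) ∧
    ∑ i, x i = f (Fintype.card ι)}

theorem isCompact_basePolytope [Fintype ι] (f : ℕ → ℝ) : IsCompact (basePolytope ι f) := by
  refine IsCompact.of_isClosed_subset (isCompact_Icc (a := (0 : ι → ℝ)) (b := fun _ => f 1)) ?_ ?_
  · have h : basePolytope ι f = (⋂ i, {x : ι → ℝ | 0 ≤ x i}) ∩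
        ((⋂ A : Finset ι, {x : ι → ℝ | ∑ i ∈ A, x i ≤ f A.card}) ∩
          {x : ι → ℝ | ∑ i, x i = f (Fintype.card ι)}) := by
      ext x; simp [basePolytope]
    rw [h]
    refine (isClosed_iInter fun i => isClosed_le continuous_const (by fun_prop)).inter
      ((isClosed_iInter fun A => isClosed_le (by fun_prop) continuous_const).inter
        (isClosed_eq (by fun_prop) continuous_const))
  · intro x hx
    refine ⟨fun i => hx.1 i, fun i => ?_⟩
    simpa using hx.2.1 {i}

theorem sum_transfer [DecidableEq ι] (x : ι → ℝ) (t : ℝ) (c d : ι) (A : Finset ι) :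
    ∑ i ∈ A, (x i + ((if i = d then t else 0) - if i = c then t else 0)) =
      ∑ i ∈ A, x i + ((if d ∈ A then t else 0) - if c ∈ A then t else 0) := by
  rw [Finset.sum_add_distrib, Finset.sum_sub_distrib, Finset.sum_ite_eq', Finset.sum_ite_eq']

/-- A minimizer of `∑ (L + x) ^ 2` over a base polytope: if it gives mass to `c`, although `d` has
smaller total, then some tight set separates `d` from `c`. -/
theorem exists_tight_of_isMinOn [Fintype ι] [DecidableEq ι] {f : ℕ → ℝ} {L x : ι → ℝ} (hx : x ∈ basePolytope ι f)
    (hmin : IsMinOn (fun x : ι → ℝ => ∑ i, (L i + x i) ^ 2) (basePolytope ι f) x) {c d : ι}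
    (hc : 0 < x c) (hcd : L d + x d < L c + x c) :
    ∃ T : Finset ι, ∑ i ∈ T, x i = f T.card ∧ d ∈ T ∧ c ∉ T := by
  by_contra! hT
  have hne : d ≠ c := by rintro rfl; exact lt_irrefl _ hcd
  -- Otherwise a small mass `t` can be moved from `c` to `d`: only sets that contain `d` but not `c`
  -- gain mass, and all of these have slack.
  have h1 : ∀ᶠ t : ℝ in 𝓝[>] 0, ∀ T : Finset ι, d ∈ T → c ∉ T → ∑ i ∈ T, x i + t ≤ f T.card := by
    refine eventually_all.2 fun T => ?_
    by_cases hd : d ∈ T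
    · by_cases hcT : c ∈ T
      · exact Eventually.of_forall fun t _ h => absurd hcT h
      · have hlt : ∑ i ∈ T, x i < f T.card :=
          lt_of_le_of_ne (hx.2.1 T) fun h => hcT (hT T h hd)
        have : ∀ᶠ t : ℝ in 𝓝[>] 0, t < f T.card - ∑ i ∈ T, x i :=
          mem_nhdsWithin_of_mem_nhds (Iio_mem_nhds (by linarith))
        filter_upwards [this] with t ht _ _
        linarith
    · exact Eventually.of_forall fun t h => absurd h hd
  have h2 : ∀ᶠ t : ℝ in 𝓝[>] 0, t < x c := mem_nhdsWithin_of_mem_nhds (Iio_mem_nhds hc)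
  have h3 : ∀ᶠ t : ℝ in 𝓝[>] 0, t < (L c + x c) - (L d + x d) :=
    mem_nhdsWithin_of_mem_nhds (Iio_mem_nhds (by linarith))
  obtain ⟨t, h1, h2, h3, ht⟩ := (h1.and (h2.and (h3.and self_mem_nhdsWithin))).exists
  have ht : 0 < t := ht
  set y : ι → ℝ := fun i => x i + ((if i = d then t else 0) - if i = c then t else 0) with hy
  have hyP : y ∈ basePolytope ι f := by
    refine ⟨fun i => ?_, fun A => ?_, ?_⟩
    · by_cases hic : i = c
      · simp only [hy, hic, if_true, if_neg hne.symm]; linarith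
      · have := hx.1 i
        simp only [hy, if_neg hic]; split_ifs <;> linarith
    · rw [hy, sum_transfer]
      have := hx.2.1 A
      by_cases hdA : d ∈ A
      · by_cases hcA : c ∈ A
        · simpa [hdA, hcA] using this
        · simpa [hdA, hcA] using h1 A hdA hcA
      · rw [if_neg hdA]; split_ifs <;> linarith
    · rw [hy, sum_transfer, hx.2.2]; simp
  have hle := hmin hyP
  simp only [Set.mem_ofPred_eq] at hle
  -- The change equals 2t(t - gap), where gap is the difference of the two totals; it is negative
  -- because t < gap.
  have hdiff : ∑ i, (L i + y i) ^ 2 - ∑ i, (L i + x i) ^ 2 =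
      t * (2 * (L d + x d) + t) + t * (-2 * (L c + x c) + t) := by
    rw [← Finset.sum_sub_distrib]
    have : ∀ i, (L i + y i) ^ 2 - (L i + x i) ^ 2 =
        (if i = d then t * (2 * (L i + x i) + t) else 0) +
          if i = c then t * (-2 * (L i + x i) + t) else 0 := by
      intro i
      by_cases h1 : i = d
      · have h2 : i ≠ c := fun h => hne (h1 ▸ h)
        simp only [hy, if_pos h1, if_neg h2]; ring
      · by_cases h2 : i = c
        · simp only [hy, if_neg h1, if_pos h2]; ring
        · simp only [hy, if_neg h1, if_neg h2]; ring
    simp only [this]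
    rw [Finset.sum_add_distrib, Finset.sum_ite_eq', Finset.sum_ite_eq']
    simp
  nlinarith

/-- In the base polytope of a function of the cardinality which is monotone and submodular there
is a point `x` such that all sublevel sets of `L + x` are tight. -/
theorem exists_fair_point [Fintype ι] [DecidableEq ι] {f : ℕ → ℝ} (hmono : Monotone f) (h0 : f 0 = 0)
    (hsub : ∀ A B : Finset ι, f (A ∪ B).card + f (A ∩ B).card ≤ f A.card + f B.card)
    (hne : (basePolytope ι f).Nonempty) (L : ι → ℝ) :
    ∃ x ∈ basePolytope ι f, ∀ r : ℝ,
      ∑ i with L i + x i ≤ r, x i = f (Finset.univ.filter fun i => L i + x i ≤ r).card := by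
  obtain ⟨x, hx, hmin⟩ := (isCompact_basePolytope (ι := ι) f).exists_isMinOn hne
    (f := fun x : ι → ℝ => ∑ i, (L i + x i) ^ 2) (by fun_prop)
  refine ⟨x, hx, fun r => ?_⟩
  set S : Finset ι := Finset.univ.filter fun i => L i + x i ≤ r with hS
  by_contra hlt
  have hlt : ∑ i ∈ S, x i < f S.card := lt_of_le_of_ne (hx.2.1 S) hlt
  -- Submodularity makes tight sets closed under union and intersection.
  have hunion : ∀ A B : Finset ι, ∑ i ∈ A, x i = f A.card → ∑ i ∈ B, x i = f B.card →
      ∑ i ∈ A ∪ B, x i = f (A ∪ B).card ∧ ∑ i ∈ A ∩ B, x i = f (A ∩ B).card := by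
    intro A B hA hB
    have h1 := Finset.sum_union_inter (s₁ := A) (s₂ := B) (f := x)
    have h2 := hsub A B
    have h3 := hx.2.1 (A ∪ B)
    have h4 := hx.2.1 (A ∩ B)
    constructor <;> linarith
  -- The union over `d ∈ S` of tight sets that contain `d` and avoid `c`.
  have hsep : ∀ c, c ∉ S → 0 < x c →
      ∃ T : Finset ι, ∑ i ∈ T, x i = f T.card ∧ S ⊆ T ∧ c ∉ T := by
    intro c hcS hc
    have hcr : r < L c + x c := by simpa [hS] using hcS
    have : ∀ U : Finset ι, U ⊆ S →
        ∃ T : Finset ι, ∑ i ∈ T, x i = f T.card ∧ U ⊆ T ∧ c ∉ T := by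
      intro U
      induction U using Finset.induction_on with
      | empty => exact fun _ => ⟨∅, by simp [h0], by simp, by simp⟩
      | insert d U _ ih =>
        intro hU
        obtain ⟨T, hT, hUT, hcT⟩ := ih fun i hi => hU (Finset.mem_insert_of_mem hi)
        have hd : L d + x d ≤ r := by simpa [hS] using hU (Finset.mem_insert_self d U)
        obtain ⟨T', hT', hdT', hcT'⟩ := exists_tight_of_isMinOn hx hmin hc (hd.trans_lt hcr)
        refine ⟨T' ∪ T, (hunion _ _ hT' hT).1, ?_, by simp [hcT, hcT']⟩
        exact Finset.insert_subset (Finset.mem_union_left _ hdT')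
          (hUT.trans Finset.subset_union_right)
    exact this S subset_rfl
  -- The intersection of these sets over all `c` outside `S` that carry mass.
  have hinter : ∀ W : Finset ι, (∀ c ∈ W, c ∉ S ∧ 0 < x c) →
      ∃ T : Finset ι, ∑ i ∈ T, x i = f T.card ∧ S ⊆ T ∧ ∀ c ∈ W, c ∉ T := by
    intro W
    induction W using Finset.induction_on with
    | empty => exact fun _ => ⟨Finset.univ, by rw [hx.2.2, Finset.card_univ], by simp, by simp⟩
    | insert d W _ ih =>
      intro hW
      obtain ⟨T, hT, hST, hWT⟩ := ih fun c hc => hW c (Finset.mem_insert_of_mem hc)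
      obtain ⟨hdS, hd⟩ := hW d (Finset.mem_insert_self d W)
      obtain ⟨T', hT', hST', hdT'⟩ := hsep d hdS hd
      refine ⟨T' ∩ T, (hunion _ _ hT' hT).2, Finset.subset_inter hST' hST, ?_⟩
      intro c hc hcT
      rw [Finset.mem_inter] at hcT
      rcases Finset.mem_insert.1 hc with rfl | hc
      · exact hdT' hcT.1
      · exact hWT c hc hcT.2
  obtain ⟨T, hT, hST, hWT⟩ := hinter (Finset.univ.filter fun c => c ∉ S ∧ 0 < x c) (by simp)
  -- The tight set `T` exceeds `S` only by elements without mass, so `S` carries f #T ≥ f #S and is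
  -- tight as well.
  have hTS : ∑ i ∈ S, x i = ∑ i ∈ T, x i := by
    refine Finset.sum_subset hST fun c hcT hcS => ?_
    by_contra hc
    exact hWT c (by simp [hcS, lt_of_le_of_ne (hx.1 c) (Ne.symm hc)]) hcT
  have := hmono (Finset.card_le_card hST)
  linarith

end FairPoint

end OnlineEdgeColoring

/-! ### The fractional color of one edge and the balance invariant -/

namespace OnlineEdgeColoring

/-- Up to scaling by the degree bound, the largest mass that the fractional coloring of one edge
may give to sets of colors of a given size. -/
noncomputable def profile (r : ℝ) : ℝ := min (0.9 * r) (min (0.38 + 0.5 * r) 1)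

theorem profile_le_mul (r : ℝ) : profile r ≤ 0.9 * r := min_le_left _ _

theorem profile_le_add (r : ℝ) : profile r ≤ 0.38 + 0.5 * r :=
  (min_le_right _ _).trans (min_le_left _ _)

theorem profile_le_one (r : ℝ) : profile r ≤ 1 := (min_le_right _ _).trans (min_le_right _ _)

theorem profile_mono : Monotone profile := by
  intro r s h
  unfold profile
  gcongr

theorem profile_eq_one {r : ℝ} (h : 1.24 ≤ r) : profile r = 1 := by
  have h1 : min (0.38 + 0.5 * r) 1 = 1 := min_eq_right (by linarith)
  rw [profile, h1]
  exact min_eq_right (by linarith)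

theorem profile_concave {a k l t : ℝ} (h0 : 0 ≤ t) (h1 : t ≤ 1) (ha : a = t * l + (1 - t) * k) :
    t * profile l + (1 - t) * profile k ≤ profile a := by
  have h1' : 0 ≤ 1 - t := by linarith
  refine le_min ?_ (le_min ?_ ?_)
  · have := mul_le_mul_of_nonneg_left (profile_le_mul l) h0
    have := mul_le_mul_of_nonneg_left (profile_le_mul k) h1'
    rw [ha]; linarith
  · have := mul_le_mul_of_nonneg_left (profile_le_add l) h0
    have := mul_le_mul_of_nonneg_left (profile_le_add k) h1'
    rw [ha]; linarith
  · have := mul_le_mul_of_nonneg_left (profile_le_one l) h0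
    have := mul_le_mul_of_nonneg_left (profile_le_one k) h1'
    linarith

/-- `a` and `b` are convex combinations of `k` and `l` with complementary weights, so this is
concavity applied twice. -/
theorem profile_submodular {a b k l : ℝ} (hla : l ≤ a) (hak : a ≤ k) (h : k + l = a + b) :
    profile k + profile l ≤ profile a + profile b := by
  rcases (hla.trans hak).eq_or_lt with hlk | hlk
  · have h1 : a = k := by linarith
    have h2 : b = l := by linarith
    rw [h1, h2]
  · have hkl : 0 < k - l := by linarith
    have hne : k - l ≠ 0 := hkl.ne'
    have h1 := profile_concave (a := a) (k := k) (l := l) (t := (k - a) / (k - l))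
      (div_nonneg (by linarith) hkl.le) ((div_le_one hkl).2 (by linarith)) (by field_simp; ring)
    have h2 := profile_concave (a := b) (k := l) (l := k) (t := (k - a) / (k - l))
      (div_nonneg (by linarith) hkl.le) ((div_le_one hkl).2 (by linarith))
      (by have : b = k + l - a := by linarith
          rw [this]; field_simp; ring)
    linarith

/-- The number of colors in use while the bound on the maximum degree is `D`. -/
noncomputable def palette (D : ℕ) : ℕ := ⌈(1.776 : ℝ) * D⌉₊

theorem le_palette (D : ℕ) : 1.776 * (D : ℝ) ≤ palette D := Nat.le_ceil _

theorem palette_le (D : ℕ) : (palette D : ℝ) ≤ 1.776 * D + 1 :=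
  (Nat.ceil_lt_add_one (by positivity)).le

theorem palette_mono : Monotone palette := by
  intro a b h
  unfold palette
  gcongr

/-- `x` distributes one edge over the colors of the palette, on top of the loads `L` at its earlier
endpoint, in a way that is as fair as `profile` allows. -/
structure IsFairShare (D : ℕ) (L x : ℕ → ℝ) : Prop where
  nonneg : ∀ c, 0 ≤ x c
  eq_zero : ∀ c, palette D ≤ c → x c = 0
  sum_eq : ∑ c ∈ Finset.range (palette D), x c = 1
  sum_le : ∀ A ⊆ Finset.range (palette D), ∑ c ∈ A, x c ≤ profile (A.card / D)
  sum_sublevel : ∀ r : ℝ, ∑ c ∈ Finset.range (palette D) with L c + x c ≤ r, x c =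
    profile (((Finset.range (palette D)).filter fun c => L c + x c ≤ r).card / D)

/-- The base polytope is nonempty because the uniform distribution obeys the caps: a set of rD
colors gets at most r/1.776, which is below 0.9r, and below 0.38 + 0.5r when r ≤ 2. For r > 2 the
latter cap exceeds 1. -/
theorem exists_isFairShare {D : ℕ} (hD : 0 < D) (L : ℕ → ℝ) : ∃ x, IsFairShare D L x := by
  classical
  set K := palette D with hK
  have hD' : (0 : ℝ) < D := by exact_mod_cast hD
  have hKD : 1.776 * (D : ℝ) ≤ K := le_palette D
  have hK0 : (0 : ℝ) < K := by nlinarith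
  set f : ℕ → ℝ := fun m => profile (m / D) with hf
  have hfK : f K = 1 := profile_eq_one (by rw [le_div_iff₀ hD']; nlinarith)
  have hmono : Monotone f := fun a b h => profile_mono (by gcongr)
  have h0 : f 0 = 0 := by simp [hf, profile]; norm_num
  have hsub : ∀ A B : Finset (Fin K),
      f (A ∪ B).card + f (A ∩ B).card ≤ f A.card + f B.card := by
    intro A B
    refine profile_submodular ?_ ?_ ?_
    · gcongr; exact Finset.inter_subset_left
    · gcongr; exact Finset.subset_union_left
    · rw [← add_div, ← add_div]
      congr 1
      exact_mod_cast Finset.card_union_add_card_inter A B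
  have hne : (basePolytope (Fin K) f).Nonempty := by
    refine ⟨fun _ => 1 / K, fun _ => by positivity, fun A => ?_, ?_⟩
    · have hA : (A.card : ℝ) ≤ K := by
        exact_mod_cast (Finset.card_le_univ A).trans (by simp)
      have hA0 : (0 : ℝ) ≤ A.card := by positivity
      have hAK : (A.card : ℝ) * (1 / K) ≤ A.card / D / 1.776 := by
        rw [div_div, mul_one_div]
        gcongr
        linarith
      have hA1 : (A.card : ℝ) * (1 / K) ≤ 1 := by
        rw [mul_one_div]; exact (div_le_one hK0).2 hA
      have hAD : (0 : ℝ) ≤ A.card / D := by positivity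
      simp only [Finset.sum_const, nsmul_eq_mul]
      refine le_min ?_ (le_min ?_ hA1)
      · refine hAK.trans ?_
        rw [div_le_iff₀ (by norm_num)]; nlinarith
      · by_cases h : (A.card : ℝ) / D ≤ 2
        · refine hAK.trans ?_
          rw [div_le_iff₀ (by norm_num)]; nlinarith
        · refine hA1.trans ?_
          push Not at h
          linarith
    · simp only [Finset.sum_const, nsmul_eq_mul, Finset.card_univ, Fintype.card_fin, hfK]
      field_simp
  obtain ⟨x, ⟨hx0, hxA, hx1⟩, hr⟩ := exists_fair_point hmono h0 hsub hne (fun i => L i)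
  set y : ℕ → ℝ := fun c => if h : c < K then x ⟨c, h⟩ else 0 with hy
  have hyx : ∀ i : Fin K, y i = x i := fun i => by simp [hy]
  have hset : ∀ A ⊆ Finset.range K,
      (Finset.univ.filter fun i : Fin K => (i : ℕ) ∈ A).map Fin.valEmbedding = A := by
    intro A hA
    ext c
    simp only [Finset.mem_map, Finset.mem_filter, Finset.mem_univ, true_and,
      Fin.valEmbedding_apply]
    constructor
    · rintro ⟨i, hi, rfl⟩; exact hi
    · exact fun hc => ⟨⟨c, Finset.mem_range.1 (hA hc)⟩, hc, rfl⟩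
  have hcard : ∀ A ⊆ Finset.range K,
      (Finset.univ.filter fun i : Fin K => (i : ℕ) ∈ A).card = A.card := by
    intro A hA
    conv_rhs => rw [← hset A hA, Finset.card_map]
  have hsum : ∀ A ⊆ Finset.range K,
      ∑ c ∈ A, y c = ∑ i ∈ Finset.univ.filter fun i : Fin K => (i : ℕ) ∈ A, x i := by
    intro A hA
    conv_lhs => rw [← hset A hA, Finset.sum_map]
    exact Finset.sum_congr rfl fun i _ => hyx i
  refine ⟨y, fun c => ?_, fun c hc => ?_, ?_, fun A hA => ?_, fun r => ?_⟩
  · simp only [hy]; split_ifs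
    · exact hx0 _
    · exact le_rfl
  · exact dif_neg (not_lt.2 hc)
  · rw [hsum _ subset_rfl]
    simpa [hfK] using hx1
  · rw [hsum A hA, ← hcard A hA]
    exact hxA _
  · rw [hsum _ (Finset.filter_subset _ _), ← hcard _ (Finset.filter_subset _ _)]
    have : (Finset.univ.filter fun i : Fin K =>
        (i : ℕ) ∈ (Finset.range K).filter fun c => L c + y c ≤ r) =
        Finset.univ.filter fun i : Fin K => L i + x i ≤ r := by
      ext i; simp [hyx]
    rw [this]
    exact hr r

open Classical in
/-- The fractional coloring chosen for an edge whose earlier endpoint has the loads `L`. -/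
noncomputable def share (D : ℕ) (L : ℕ → ℝ) : ℕ → ℝ :=
  if h : ∃ x, IsFairShare D L x then h.choose else 0

theorem isFairShare_share {D : ℕ} (hD : 0 < D) (L : ℕ → ℝ) : IsFairShare D L (share D L) := by
  rw [share, dif_pos (exists_isFairShare hD L)]
  exact (exists_isFairShare hD L).choose_spec

theorem IsFairShare.le {D : ℕ} {L x : ℕ → ℝ} (h : IsFairShare D L x) (c : ℕ) : x c ≤ 1 / D := by
  by_cases hc : c < palette D
  · have h1 := h.sum_le {c} (by simpa using hc)
    simp only [Finset.sum_singleton, Finset.card_singleton, Nat.cast_one] at h1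
    have h2 := profile_le_mul (1 / D)
    have h3 : (0 : ℝ) ≤ 1 / D := by positivity
    linarith
  · rw [h.eq_zero c (not_lt.1 hc)]; positivity

theorem IsFairShare.sum_le_profile {D : ℕ} {L x : ℕ → ℝ} (h : IsFairShare D L x) (A : Finset ℕ) :
    ∑ c ∈ A, x c ≤ profile (A.card / D) := by
  have h1 : ∑ c ∈ A with c < palette D, x c = ∑ c ∈ A, x c := by
    refine Finset.sum_filter_of_ne fun c _ hc => ?_
    by_contra hlt
    exact hc (h.eq_zero c (not_lt.1 hlt))
  rw [← h1]
  refine (h.sum_le _ fun c hc => ?_).trans (profile_mono ?_)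
  · simpa using (Finset.mem_filter.1 hc).2
  · gcongr; exact Finset.filter_subset _ _

/-- The heavy colors get only what the tight sublevel set leaves over, and that set contains at
least 1.776 `D` colors minus the heavy ones. -/
theorem IsFairShare.sum_superlevel {D : ℕ} (hD : 0 < D) {L x : ℕ → ℝ} (h : IsFairShare D L x)
    (r : ℝ) : ∑ c ∈ Finset.range (palette D) with r < L c + x c, x c ≤
      1 - profile (1.776 -
        ((Finset.range (palette D)).filter fun c => r < L c + x c).card / D) := by
  have hD' : (0 : ℝ) < D := by exact_mod_cast hD
  have h1 := Finset.sum_filter_add_sum_filter_not (Finset.range (palette D))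
    (fun c => L c + x c ≤ r) x
  have h2 := Finset.card_filter_add_card_filter_not (s := Finset.range (palette D))
    (fun c => L c + x c ≤ r)
  simp only [not_le, Finset.card_range] at h1 h2
  have h3 : (((Finset.range (palette D)).filter fun c => L c + x c ≤ r).card : ℝ) +
      ((Finset.range (palette D)).filter fun c => r < L c + x c).card = palette D := by
    exact_mod_cast h2
  have h4 : profile (1.776 - ((Finset.range (palette D)).filter fun c => r < L c + x c).card / D) ≤
      profile (((Finset.range (palette D)).filter fun c => L c + x c ≤ r).card / D) := by
    refine profile_mono ?_
    rw [le_div_iff₀ hD', sub_mul, div_mul_cancel₀ _ hD'.ne']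
    have := le_palette D
    linarith
  rw [h.sum_sublevel r, h.sum_eq] at h1
  linarith

/-- Slopes (in the degree) of the bounds on the excess load of a vertex. -/
noncomputable def slope : ℕ → ℝ
  | 0 => 1
  | i + 1 => 1 - profile (0.536 + 0.064 * i)

/-- Thresholds above which the load of a color counts as excess load. -/
noncomputable def threshold : ℕ → ℝ
  | 0 => 0
  | 1 => 0.3891
  | 2 => 0.4381
  | 3 => 0.4899
  | 4 => 0.5449
  | 5 => 0.6035
  | 6 => 0.6662
  | 7 => 0.7335
  | 8 => 0.7891
  | 9 => 0.8331
  | 10 => 0.8813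
  | 11 => 0.9347
  | _ => 0.9945

/-- This recursion determines the thresholds: each increment is the drop of the slope divided by
1.24 - 0.064i, rounded up to four decimals. The grid of sizes runs from 1.24 down to 0.536, and 1.24
+ 0.536 = 1.776. -/
theorem slope_sub_le {i : ℕ} (hi : i < 12) :
    slope i - slope (i + 1) ≤ (threshold (i + 1) - threshold i) * (1.24 - 0.064 * i) := by
  interval_cases i <;> norm_num [slope, threshold, profile, min_def]

theorem threshold_le_succ {i : ℕ} (hi : i < 12) : threshold i ≤ threshold (i + 1) := by
  interval_cases i <;> norm_num [threshold]

theorem threshold_nonneg {i : ℕ} (hi : i ≤ 12) : 0 ≤ threshold i := by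
  interval_cases i <;> norm_num [threshold]

theorem slope_nonneg (i : ℕ) : 0 ≤ slope i := by
  cases i with
  | zero => norm_num [slope]
  | succ i => have := profile_le_one (0.536 + 0.064 * i); simp only [slope]; linarith

theorem slope_last : slope 12 = 0 := by norm_num [slope, profile, min_def]

/-- `profile` is piecewise linear with kinks at 0.95 and 1.24 and constant afterwards, so a
nondecreasing line needs to be compared with it only at 0 and at the kinks. -/
theorem profile_le_slope_add {i : ℕ} (hi : i ≤ 12) {r : ℝ} (hr : 0 ≤ r) :
    profile r ≤ slope i + threshold i * r := by
  have h1 : 0.855 ≤ slope i + threshold i * 0.95 ∧ 1 ≤ slope i + threshold i * 1.24 := by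
    interval_cases i <;> norm_num [slope, threshold, profile, min_def]
  have h2 := slope_nonneg i
  have h3 := threshold_nonneg hi
  have h4 := profile_le_mul r
  have h5 := profile_le_add r
  have h6 := profile_le_one r
  by_cases h7 : r ≤ 0.95
  · nlinarith
  · by_cases h8 : r ≤ 1.24
    · push Not at h7
      nlinarith
    · push Not at h8
      nlinarith

/-- The invariant of the fractional coloring for a vertex of degree `d` with loads `L`. -/
structure IsBalanced (L : ℕ → ℝ) (d : ℕ) : Prop where
  nonneg : ∀ c, 0 ≤ L c
  sum_sub_le : ∀ i ≤ 12, ∀ A : Finset ℕ, ∑ c ∈ A, (L c - threshold i) ≤ slope i * d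

/-- The last slope vanishes, so no single color exceeds the last threshold, 0.9945. -/
theorem IsBalanced.le {L : ℕ → ℝ} {d : ℕ} (h : IsBalanced L d) (c : ℕ) : L c ≤ 0.995 := by
  have := h.sum_sub_le 12 le_rfl {c}
  rw [slope_last] at this
  norm_num [threshold] at this
  linarith

theorem isBalanced_zero (d : ℕ) : IsBalanced 0 d := by
  refine ⟨fun _ => le_rfl, fun i hi A => ?_⟩
  have h1 := threshold_nonneg hi
  have h2 := slope_nonneg i
  have h3 : ∑ c ∈ A, ((0 : ℕ → ℝ) c - threshold i) ≤ 0 :=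
    Finset.sum_nonpos fun c _ => by simpa using h1
  exact h3.trans (by positivity)

/-- The load of a newly arrived vertex is balanced. -/
theorem isBalanced_sum {ι : Type*} {D : ℕ} {s : Finset ι} (hs : s.card ≤ D) {L x : ι → ℕ → ℝ}
    (h : ∀ i ∈ s, IsFairShare D (L i) (x i)) : IsBalanced (fun c => ∑ i ∈ s, x i c) s.card := by
  refine ⟨fun c => Finset.sum_nonneg fun i hi => (h i hi).nonneg c, fun i hi A => ?_⟩
  rw [Finset.sum_sub_distrib, Finset.sum_comm, Finset.sum_const, nsmul_eq_mul]
  have h1 : ∑ j ∈ s, ∑ c ∈ A, x j c ≤ s.card * profile (A.card / D) := by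
    rw [← nsmul_eq_mul]
    exact Finset.sum_le_card_nsmul _ _ _ fun j hj => (h j hj).sum_le_profile A
  have h2 := profile_le_slope_add hi (r := A.card / D) (by positivity)
  -- As there are at most `D` edges, the linear bound on `profile`, summed over them, becomes a
  -- bound on the excess above the threshold.
  have h3 : (s.card : ℝ) * (A.card / D) ≤ A.card := by
    rcases Nat.eq_zero_or_pos D with rfl | hD
    · simp
    · rw [← mul_div_assoc, div_le_iff₀ (by exact_mod_cast hD), mul_comm]
      gcongr
  have h4 := threshold_nonneg hi
  have h5 := mul_le_mul_of_nonneg_left h2 (Nat.cast_nonneg (α := ℝ) s.card)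
  have h6 := mul_le_mul_of_nonneg_left h3 h4
  nlinarith

/-- Induction on the threshold. Let `S` be the set of colors whose new load exceeds threshold i + 1.
If `S` is small, fairness puts at most slope i + 1 of the new edge on it. If `S` is large, the bound
for threshold i already implies the next one, since raising the threshold subtracts the increment
once for each color in `S`. -/
theorem IsBalanced.add_share {D d : ℕ} (hd : d + 1 ≤ D) {L x : ℕ → ℝ} (hL : IsBalanced L d)
    (hsupp : ∀ c, palette D ≤ c → L c = 0) (hx : IsFairShare D L x) :
    IsBalanced (fun c => L c + x c) (d + 1) := by
  have hD : 0 < D := by omega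
  have hD' : (0 : ℝ) < D := by exact_mod_cast hD
  have hdD : (d : ℝ) + 1 ≤ D := by exact_mod_cast hd
  refine ⟨fun c => add_nonneg (hL.nonneg c) (hx.nonneg c), fun i => ?_⟩
  induction i with
  | zero =>
    intro _ A
    have h1 := hL.sum_sub_le 0 (by norm_num) A
    have h2 := (hx.sum_le_profile A).trans (profile_le_one _)
    simp only [threshold, slope, sub_zero] at h1 ⊢
    rw [Finset.sum_add_distrib]
    push_cast
    linarith
  | succ i ih =>
    intro hi A
    have ih := ih (by omega)
    have hi' : i < 12 := by omega
    set q := threshold (i + 1) with hq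
    have hq0 : 0 ≤ q := threshold_nonneg hi
    set S := (Finset.range (palette D)).filter fun c => q < L c + x c with hS
    have hAS : ∑ c ∈ A, (L c + x c - q) ≤ ∑ c ∈ S, (L c + x c - q) := by
      have h1 : ∑ c ∈ A, (L c + x c - q) ≤ ∑ c ∈ A with c ∈ S, (L c + x c - q) := by
        rw [← Finset.sum_filter_add_sum_filter_not A (fun c => c ∈ S)]
        refine add_le_of_nonpos_right (Finset.sum_nonpos fun c hc => ?_)
        have hc := (Finset.mem_filter.1 hc).2
        by_cases hcK : c < palette D
        · simp only [hS, Finset.mem_filter, Finset.mem_range, hcK, true_and, not_lt] at hc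
          linarith
        · rw [hsupp c (not_lt.1 hcK), hx.eq_zero c (not_lt.1 hcK)]
          linarith
      refine h1.trans (Finset.sum_le_sum_of_subset_of_nonneg ?_ fun c hc _ => ?_)
      · exact fun c hc => (Finset.mem_filter.1 hc).2
      · have := (Finset.mem_filter.1 hc).2
        linarith
    refine hAS.trans ?_
    push_cast
    by_cases hN : (S.card : ℝ) / D ≤ 1.24 - 0.064 * i
    · have h1 := hL.sum_sub_le (i + 1) hi S
      have h2 := hx.sum_superlevel hD q
      -- Here 1.776 - (1.24 - 0.064i) = 0.536 + 0.064i.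
      have h3 : profile (0.536 + 0.064 * i) ≤ profile (1.776 - S.card / D) :=
        profile_mono (by linarith)
      have h4 : ∑ c ∈ S, (L c + x c - q) = ∑ c ∈ S, (L c - q) + ∑ c ∈ S, x c := by
        rw [← Finset.sum_add_distrib]
        exact Finset.sum_congr rfl fun c _ => by ring
      rw [h4]
      have h5 : slope (i + 1) = 1 - profile (0.536 + 0.064 * i) := rfl
      rw [← hS] at h2
      linarith
    · push Not at hN
      have h1 := ih S
      have h2 := slope_sub_le hi'
      have h3 := threshold_le_succ hi'
      have h4 : ∑ c ∈ S, (L c + x c - q) =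
          ∑ c ∈ S, (L c + x c - threshold i) - S.card * (q - threshold i) := by
        rw [← nsmul_eq_mul, ← Finset.sum_const, ← Finset.sum_sub_distrib]
        exact Finset.sum_congr rfl fun c _ => by ring
      rw [h4]
      push_cast at h1
      have hs : (1.24 - 0.064 * (i : ℝ)) * (d + 1) ≤ S.card := by
        rw [lt_div_iff₀ hD'] at hN
        have : (i : ℝ) ≤ 11 := by exact_mod_cast Nat.le_of_lt_succ hi'
        nlinarith
      have h5 := mul_le_mul_of_nonneg_right hs (sub_nonneg.2 h3)
      have h6 := mul_le_mul_of_nonneg_right h2 (by positivity : (0 : ℝ) ≤ d + 1)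
      linarith

end OnlineEdgeColoring

/-! ### The online fractional coloring of the whole graph -/

namespace OnlineEdgeColoring

open Classical in
/-- The number of neighbors of `u` among the first `j` vertices. -/
noncomputable def degreeBelow (g : SimpleGraph ℕ) (j u : ℕ) : ℕ :=
  ((Finset.range j).filter fun i => g.Adj u i).card

/-- The bound on the maximum degree in use when vertex `j` has arrived: the maximum degree so far,
but at least `D₀`. -/
noncomputable def degreeBound (D₀ : ℕ) (g : SimpleGraph ℕ) (j : ℕ) : ℕ :=
  max D₀ ((Finset.range (j + 1)).sup (degreeBelow g (j + 1)))

open Classical in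
/-- The load of the color `c` at the vertex `u` before the arrival of vertex `j`, in the fractional
coloring. -/
noncomputable def load (D₀ : ℕ) (g : SimpleGraph ℕ) : ℕ → ℕ → ℕ → ℝ
  | 0 => fun _ _ => 0
  | j + 1 => fun u c => load D₀ g j u c +
      (if u < j ∧ g.Adj u j then share (degreeBound D₀ g j) (load D₀ g j u) c else 0) +
      if u = j then ∑ i ∈ (Finset.range j).filter fun i => g.Adj j i,
        share (degreeBound D₀ g j) (load D₀ g j i) c else 0

/-- The fractional coloring of the edge between `i` and a later vertex `j`. -/
noncomputable def fracColor (D₀ : ℕ) (g : SimpleGraph ℕ) (i j : ℕ) : ℕ → ℝ :=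
  share (degreeBound D₀ g j) (load D₀ g j i)

theorem degreeBelow_mono (g : SimpleGraph ℕ) (u : ℕ) {j k : ℕ} (h : j ≤ k) :
    degreeBelow g j u ≤ degreeBelow g k u := by
  classical
  exact Finset.card_le_card (Finset.filter_subset_filter _ (Finset.range_mono h))

theorem degreeBound_mono (D₀ : ℕ) (g : SimpleGraph ℕ) : Monotone (degreeBound D₀ g) := by
  intro j k h
  refine max_le_max le_rfl (Finset.sup_le fun u hu => ?_)
  refine (degreeBelow_mono g u (by omega : j + 1 ≤ k + 1)).trans ?_
  exact Finset.le_sup (f := degreeBelow g (k + 1)) (by simp at hu ⊢; omega)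

theorem le_degreeBound (D₀ : ℕ) (g : SimpleGraph ℕ) (j : ℕ) : D₀ ≤ degreeBound D₀ g j :=
  le_max_left _ _

theorem degreeBelow_le_degreeBound (D₀ : ℕ) (g : SimpleGraph ℕ) {j u : ℕ} (h : u ≤ j) :
    degreeBelow g (j + 1) u ≤ degreeBound D₀ g j :=
  (Finset.le_sup (f := degreeBelow g (j + 1)) (by simp; omega)).trans (le_max_right _ _)

theorem degreeBelow_succ_of_adj {g : SimpleGraph ℕ} {j u : ℕ} (h : g.Adj u j) :
    degreeBelow g (j + 1) u = degreeBelow g j u + 1 := by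
  classical
  simp only [degreeBelow]
  rw [Finset.range_add_one, Finset.filter_insert, if_pos h, Finset.card_insert_of_notMem (by simp)]

theorem degreeBelow_succ_of_not_adj {g : SimpleGraph ℕ} {j u : ℕ} (h : ¬ g.Adj u j) :
    degreeBelow g (j + 1) u = degreeBelow g j u := by
  classical
  simp only [degreeBelow]
  rw [Finset.range_add_one, Finset.filter_insert, if_neg h]

theorem load_of_le {D₀ : ℕ} {g : SimpleGraph ℕ} {j u : ℕ} (h : j ≤ u) : load D₀ g j u = 0 := by
  induction j with
  | zero => rfl
  | succ j ih =>
    ext c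
    have h1 : ¬ (u < j ∧ g.Adj u j) := by omega
    have h2 : u ≠ j := by omega
    simp [load, ih (by omega), if_neg h1, if_neg h2]

/-- Palettes only grow, so old loads live on the current palette; `IsBalanced.add_share` needs this.
-/
theorem load_eq_zero {D₀ : ℕ} (hD₀ : 0 < D₀) {g : SimpleGraph ℕ} {j D : ℕ}
    (hD : ∀ k < j, degreeBound D₀ g k ≤ D) (u c : ℕ) (hc : palette D ≤ c) :
    load D₀ g j u c = 0 := by
  induction j generalizing u with
  | zero => rfl
  | succ j ih =>
    have ih := ih fun k hk => hD k (by omega)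
    have hs : ∀ i, share (degreeBound D₀ g j) (load D₀ g j i) c = 0 := fun i =>
      (isFairShare_share (hD₀.trans_le (le_degreeBound D₀ g j)) _).eq_zero c
        ((palette_mono (hD j (by omega))).trans hc)
    simp [load, ih u, hs]

/-- An arrival adds at most one edge at each earlier vertex, with a share that is fair for the loads
there; the arriving vertex starts from zero load and gets all its edges at once. -/
theorem isBalanced_load {D₀ : ℕ} (hD₀ : 0 < D₀) (g : SimpleGraph ℕ) (j u : ℕ) :
    IsBalanced (load D₀ g j u) (degreeBelow g j u) := by
  classical
  induction j generalizing u with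
  | zero => exact isBalanced_zero _
  | succ j ih =>
    have hpos : 0 < degreeBound D₀ g j := hD₀.trans_le (le_degreeBound D₀ g j)
    rcases lt_trichotomy u j with h | h | h
    · by_cases hadj : g.Adj u j
      · have hl : load D₀ g (j + 1) u = fun c => load D₀ g j u c +
            share (degreeBound D₀ g j) (load D₀ g j u) c := by
          ext c; simp [load, h, hadj, h.ne]
        rw [hl, degreeBelow_succ_of_adj hadj]
        refine (ih u).add_share ?_ (fun c hc => ?_) (isFairShare_share hpos _)
        · rw [← degreeBelow_succ_of_adj hadj]
          exact degreeBelow_le_degreeBound D₀ g h.le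
        · exact load_eq_zero hD₀ (fun k hk => degreeBound_mono D₀ g hk.le) u c hc
      · have hl : load D₀ g (j + 1) u = load D₀ g j u := by
          ext c; simp [load, hadj, h.ne]
        rw [hl, degreeBelow_succ_of_not_adj hadj]
        exact ih u
    · subst h
      have hl : load D₀ g (u + 1) u = fun c => ∑ i ∈ (Finset.range u).filter fun i => g.Adj u i,
          share (degreeBound D₀ g u) (load D₀ g u i) c := by
        ext c; simp [load, load_of_le le_rfl]
      have hd : degreeBelow g (u + 1) u =
          ((Finset.range u).filter fun i => g.Adj u i).card := by
        rw [degreeBelow_succ_of_not_adj (g.irrefl)]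
        rfl
      rw [hl, hd]
      refine isBalanced_sum ?_ fun i _ => isFairShare_share hpos _
      rw [← hd]
      exact degreeBelow_le_degreeBound D₀ g le_rfl
    · rw [load_of_le (by omega)]
      exact isBalanced_zero _

open Classical in
/-- The load is the sum of the fractional colors of the edges at a vertex. -/
theorem load_eq_sum {D₀ : ℕ} {g : SimpleGraph ℕ} (j u c : ℕ) (hu : u < j) :
    load D₀ g j u c = ∑ i ∈ (Finset.range j).filter fun i => g.Adj u i,
      fracColor D₀ g (min u i) (max u i) c := by
  induction j with
  | zero => omega
  | succ j ih =>
    rw [Finset.range_add_one, Finset.filter_insert]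
    rcases (Nat.lt_succ_iff.1 hu).eq_or_lt with h | h
    · subst h
      rw [if_neg (g.irrefl)]
      simp only [load, load_of_le le_rfl, lt_irrefl, false_and, if_false, if_true, Pi.zero_apply,
        zero_add, add_zero]
      refine Finset.sum_congr rfl fun i hi => ?_
      have : i < u := by simpa using (Finset.mem_filter.1 hi).1
      rw [min_eq_right this.le, max_eq_left this.le, fracColor]
    · by_cases hadj : g.Adj u j
      · rw [if_pos hadj, Finset.sum_insert (by simp), ← ih h, min_eq_left h.le, max_eq_right h.le]
        simp [load, h, hadj, h.ne, fracColor, add_comm]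
      · rw [if_neg hadj, ← ih h]
        simp [load, hadj, h.ne]

theorem sum_fracColor_le {D₀ : ℕ} (hD₀ : 0 < D₀) {g : SimpleGraph ℕ} (n u c : ℕ) (hu : u < n)
    [DecidableRel g.Adj] :
    ∑ i ∈ (Finset.range n).filter fun i => g.Adj u i,
      fracColor D₀ g (min u i) (max u i) c ≤ 0.995 := by
  convert (isBalanced_load hD₀ g n u).le c
  rw [load_eq_sum n u c hu]
  congr

/-! ### The fractional coloring depends only on the revealed graph -/

section Locality

variable {D₀ : ℕ} {g h : SimpleGraph ℕ} {m : ℕ}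

theorem degreeBelow_congr (H : ∀ u < m, ∀ v < m, (g.Adj u v ↔ h.Adj u v)) {j u : ℕ} (hj : j ≤ m)
    (hu : u < m) : degreeBelow g j u = degreeBelow h j u := by
  classical
  refine congrArg Finset.card (Finset.filter_congr fun i hi => H u hu i ?_)
  have := Finset.mem_range.1 hi
  omega

theorem degreeBound_congr (H : ∀ u < m, ∀ v < m, (g.Adj u v ↔ h.Adj u v)) {j : ℕ} (hj : j < m) :
    degreeBound D₀ g j = degreeBound D₀ h j := by
  refine congrArg (max D₀) (Finset.sup_congr rfl fun u hu => degreeBelow_congr H hj ?_)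
  have := Finset.mem_range.1 hu
  omega

theorem load_congr (H : ∀ u < m, ∀ v < m, (g.Adj u v ↔ h.Adj u v)) {j : ℕ} (hj : j ≤ m) :
    load D₀ g j = load D₀ h j := by
  classical
  induction j with
  | zero => rfl
  | succ j ih =>
    ext u c
    simp only [load, ih (by omega), degreeBound_congr (D₀ := D₀) H (by omega : j < m)]
    congr 1
    · congr 1
      by_cases hu : u < j
      · have := H u (by omega) j (by omega)
        simp only [this]
      · simp [hu]
    · have : (Finset.range j).filter (fun i => g.Adj j i) =
          (Finset.range j).filter (fun i => h.Adj j i) := by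
        refine Finset.filter_congr fun i hi => H j (by omega) i ?_
        have := Finset.mem_range.1 hi
        omega
      rw [this]

theorem fracColor_congr (H : ∀ u < m, ∀ v < m, (g.Adj u v ↔ h.Adj u v)) {i j : ℕ} (hj : j < m) :
    fracColor D₀ g i j = fracColor D₀ h i j := by
  rw [fracColor, fracColor, degreeBound_congr H hj, load_congr H hj.le]

end Locality

end OnlineEdgeColoring

/-! ### One step of an exponential supermartingale -/

namespace OnlineEdgeColoring

theorem sq_sum_mul_le {ι : Type*} {s : Finset ι} {q h : ι → ℝ} (hq : ∀ i ∈ s, 0 ≤ q i)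
    (h1 : ∑ i ∈ s, q i = 1) : (∑ i ∈ s, q i * h i) ^ 2 ≤ ∑ i ∈ s, q i * h i ^ 2 := by
  have h2 : 0 ≤ ∑ i ∈ s, q i * (h i - ∑ j ∈ s, q j * h j) ^ 2 :=
    Finset.sum_nonneg fun i hi => mul_nonneg (hq i hi) (sq_nonneg _)
  set m := ∑ j ∈ s, q j * h j with hm
  have h3 : ∑ i ∈ s, q i * (h i - m) ^ 2 = ∑ i ∈ s, q i * h i ^ 2 - m ^ 2 := by
    have : ∀ i ∈ s, q i * (h i - m) ^ 2 = q i * h i ^ 2 - 2 * m * (q i * h i) + m ^ 2 * q i :=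
      fun i _ => by ring
    rw [Finset.sum_congr rfl this, Finset.sum_add_distrib, Finset.sum_sub_distrib,
      ← Finset.mul_sum, ← Finset.mul_sum, h1, ← hm]
    ring
  linarith

/-- The compensated growth of a quantity whose part `G` survives a step of probability `1 - q`. -/
noncomputable def growth (q G S : ℝ) : ℝ := G * q / (1 - q) - 128 * S * (1 / (1 - q) ^ 2 - 1)

/-- Write A for the growth and B for A + G - 128S, so that A - B is the change when the part is
lost. The expected change is A - qB: its linear terms cancel, and the compensator leaves a negative
drift. -/
theorem growth_bounds {q G S : ℝ} (hq0 : 0 ≤ q) (hq : q ≤ 1 / 2) (hS : 0 ≤ S) :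
    |growth q G S| ≤ q * (2 * |G| + 1024 * S) ∧
      |growth q G S + G - 128 * S| ≤ 2 * |G| + 1024 * S ∧
      growth q G S - q * (growth q G S + G - 128 * S) ≤ -(128 * (q * S)) := by
  have h1 : (0 : ℝ) < 1 - q := by linarith
  have hr : 1 / (1 - q) ≤ 2 := by rw [div_le_iff₀ h1]; linarith
  have hr1 : 1 ≤ 1 / (1 - q) := by rw [le_div_iff₀ h1]; linarith
  set r := 1 / (1 - q) with hrdef
  have hrq : r * (1 - q) = 1 := by rw [hrdef]; field_simp
  have hg : growth q G S = G * q * r - 128 * S * (r ^ 2 - 1) := by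
    rw [growth, hrdef]; field_simp
  have hrq' : r - 1 = q * r := by linarith
  have hr2 : r ^ 2 - 1 = q * (r * (r + 1)) := by linear_combination (r + 1) * hrq'
  have habs : |G * q * r| ≤ q * (2 * |G|) := by
    rw [abs_mul, abs_mul, abs_of_nonneg hq0, abs_of_nonneg (by linarith : 0 ≤ r)]
    have := mul_nonneg (abs_nonneg G) hq0
    nlinarith
  have habs' : |G * r| ≤ 2 * |G| := by
    rw [abs_mul, abs_of_nonneg (by linarith : 0 ≤ r)]
    nlinarith [abs_nonneg G]
  have hr3 : r * (r + 1) ≤ 6 := by nlinarith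
  refine ⟨?_, ?_, ?_⟩
  · rw [hg, hr2]
    have h2 : 0 ≤ q * S := mul_nonneg hq0 hS
    have h3 := abs_le.1 habs
    have h4 : 0 ≤ r * (r + 1) := by positivity
    rw [abs_le]
    constructor <;> nlinarith
  · have : growth q G S + G - 128 * S = G * r - 128 * S * r ^ 2 := by
      rw [hg]; linear_combination G * (-1 : ℝ) * hrq'
    rw [this]
    have h3 := abs_le.1 habs'
    have h4 : r ^ 2 ≤ 4 := by nlinarith
    have h5 : 0 ≤ r ^ 2 := sq_nonneg r
    rw [abs_le]
    constructor <;> nlinarith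
  · have : growth q G S - q * (growth q G S + G - 128 * S) = -(128 * (q * S)) * r := by
      rw [hg]
      linear_combination (G * q - 128 * S * r - 128 * S) * hrq
    rw [this]
    nlinarith [mul_nonneg hq0 hS]

/-- One step of the exponential supermartingale: when the color `d` is drawn with probability
`q d`, the parts `G c` of all other colors grow, and the part `G d` is lost. -/
theorem sum_mul_exp_le_one {s : Finset ℕ} {q G S : ℕ → ℝ} (hq0 : ∀ c ∈ s, 0 ≤ q c)
    (hq : ∀ c ∈ s, q c ≤ 1 / 2) (h1 : ∑ c ∈ s, q c = 1) (hG : ∀ c ∈ s, G c ^ 2 ≤ 2 * S c)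
    (hS : ∀ c ∈ s, S c ≤ 1 / 200000) :
    ∑ d ∈ s, q d * Real.exp (∑ c ∈ s, growth (q c) (G c) (S c) -
      (growth (q d) (G d) (S d) + G d - 128 * S d)) ≤ 1 := by
  set A : ℕ → ℝ := fun c => growth (q c) (G c) (S c) with hA
  set B : ℕ → ℝ := fun c => A c + G c - 128 * S c with hB
  set h : ℕ → ℝ := fun c => 2 * |G c| + 1024 * S c with hh
  have hS0 : ∀ c ∈ s, 0 ≤ S c := fun c hc => by nlinarith [hG c hc, sq_nonneg (G c)]
  have hbd := fun c hc => growth_bounds (G := G c) (hq0 c hc) (hq c hc) (hS0 c hc)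
  have hGabs : ∀ c ∈ s, |G c| ≤ 1 / 300 := fun c hc => by
    have h2 : G c ^ 2 ≤ (1 / 300) ^ 2 := by
      have := hG c hc
      have := hS c hc
      norm_num
      linarith
    exact abs_le_of_sq_le_sq h2 (by norm_num)
  have hh1 : ∀ c ∈ s, h c ≤ 1 / 4 := fun c hc => by
    have := hGabs c hc; have := hS c hc
    simp only [hh]; linarith
  have hh2 : ∀ c ∈ s, h c ^ 2 ≤ 27 * S c := fun c hc => by
    have h2 := hS0 c hc
    have h3 := hS c hc
    have h4 := hG c hc
    have h5 : |G c| ^ 2 = G c ^ 2 := sq_abs _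
    have h6 : S c ^ 2 ≤ 1 / 200000 * S c := by nlinarith
    simp only [hh]
    nlinarith [sq_nonneg (2 * |G c| - 1024 * S c)]
  have hAtot : |∑ c ∈ s, A c| ≤ ∑ c ∈ s, q c * h c :=
    (Finset.abs_sum_le_sum_abs _ _).trans (Finset.sum_le_sum fun c hc => (hbd c hc).1)
  have hqh : ∑ c ∈ s, q c * h c ≤ 1 / 4 := by
    calc ∑ c ∈ s, q c * h c ≤ ∑ c ∈ s, q c * (1 / 4) :=
          Finset.sum_le_sum fun c hc => mul_le_mul_of_nonneg_left (hh1 c hc) (hq0 c hc)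
      _ = 1 / 4 := by rw [← Finset.sum_mul, h1, one_mul]
  -- This uses exp X ≤ 1 + X + X² for |X| ≤ 1, and (a - b)² ≤ 2a² + 2b².
  have hX : ∀ d ∈ s, Real.exp (∑ c ∈ s, A c - B d) ≤
      1 + (∑ c ∈ s, A c - B d) + (2 * (∑ c ∈ s, A c) ^ 2 + 2 * B d ^ 2) := fun d hd => by
    have h2 : |∑ c ∈ s, A c - B d| ≤ 1 := by
      refine (abs_sub _ _).trans ?_
      have := (hbd d hd).2.1
      have := hh1 d hd
      simp only [hB, hA, hh] at *
      linarith
    have h3 := (abs_le.1 (Real.abs_exp_sub_one_sub_id_le h2)).2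
    nlinarith [sq_nonneg (∑ c ∈ s, A c + B d)]
  have hsum : ∑ d ∈ s, q d * (1 + (∑ c ∈ s, A c - B d) +
      (2 * (∑ c ∈ s, A c) ^ 2 + 2 * B d ^ 2)) =
      1 + ∑ c ∈ s, (A c - q c * B c) + 2 * (∑ c ∈ s, A c) ^ 2 + 2 * ∑ d ∈ s, q d * B d ^ 2 := by
    rw [Finset.sum_sub_distrib, Finset.mul_sum]
    have : ∀ d ∈ s, q d * (1 + (∑ c ∈ s, A c - B d) + (2 * (∑ c ∈ s, A c) ^ 2 + 2 * B d ^ 2)) =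
        (1 + ∑ c ∈ s, A c + 2 * (∑ c ∈ s, A c) ^ 2) * q d - q d * B d + 2 * (q d * B d ^ 2) :=
      fun d _ => by ring
    rw [Finset.sum_congr rfl this, Finset.sum_add_distrib, Finset.sum_sub_distrib,
      ← Finset.mul_sum, h1]
    ring
  -- The drift coefficient 128 beats the second-order terms, which contribute at most 2 * 27 + 2 *
  -- 27 = 108.
  have h2 : ∑ c ∈ s, (A c - q c * B c) ≤ -(128 * ∑ c ∈ s, q c * S c) := by
    rw [Finset.mul_sum, ← Finset.sum_neg_distrib]
    exact Finset.sum_le_sum fun c hc => (hbd c hc).2.2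
  have h3 : (∑ c ∈ s, A c) ^ 2 ≤ 27 * ∑ c ∈ s, q c * S c := by
    calc (∑ c ∈ s, A c) ^ 2 ≤ (∑ c ∈ s, q c * h c) ^ 2 := by
          rw [← sq_abs (∑ c ∈ s, A c)]
          gcongr
      _ ≤ ∑ c ∈ s, q c * h c ^ 2 := sq_sum_mul_le hq0 h1
      _ ≤ ∑ c ∈ s, q c * (27 * S c) :=
          Finset.sum_le_sum fun c hc => mul_le_mul_of_nonneg_left (hh2 c hc) (hq0 c hc)
      _ = _ := by rw [Finset.mul_sum]; exact Finset.sum_congr rfl fun c _ => by ring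
  have h4 : ∑ d ∈ s, q d * B d ^ 2 ≤ 27 * ∑ c ∈ s, q c * S c := by
    rw [Finset.mul_sum]
    refine Finset.sum_le_sum fun c hc => ?_
    have h5 : B c ^ 2 ≤ h c ^ 2 := by
      rw [← sq_abs (B c)]
      gcongr
      exact (hbd c hc).2.1
    nlinarith [mul_le_mul_of_nonneg_left (h5.trans (hh2 c hc)) (hq0 c hc)]
  have h5 : 0 ≤ ∑ c ∈ s, q c * S c :=
    Finset.sum_nonneg fun c hc => mul_nonneg (hq0 c hc) (hS0 c hc)
  calc _ ≤ ∑ d ∈ s, q d * (1 + (∑ c ∈ s, A c - B d) +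
        (2 * (∑ c ∈ s, A c) ^ 2 + 2 * B d ^ 2)) :=
        Finset.sum_le_sum fun d hd => mul_le_mul_of_nonneg_left (hX d hd) (hq0 d hd)
    _ ≤ 1 := by rw [hsum]; linarith

end OnlineEdgeColoring

/-! ### Randomized rounding: state, exponents and potential -/

namespace OnlineEdgeColoring

/-- A graph on the vertices `0, …, n - 1`, whose pairs `i < j` are processed in the order of the
slots `j * n + i`, with a fractional color vector for each slot, on the colors below `K`. -/
structure Scheme where
  /-- The number of vertices. -/
  n : ℕ
  /-- The number of colors. -/
  K : ℕ
  /-- The graph. -/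
  graph : SimpleGraph ℕ
  /-- The fraction of a color in a slot. -/
  frac : ℕ → ℕ → ℝ

/-- The slot in which the pair of `v` and `w` is processed. -/
def slot (n v w : ℕ) : ℕ := max v w * n + min v w

theorem slot_comm (n v w : ℕ) : slot n v w = slot n w v := by
  simp [slot, max_comm, min_comm]

theorem slot_of_lt (n : ℕ) {v w : ℕ} (h : v < w) : slot n v w = w * n + v := by
  simp [slot, max_eq_right h.le, min_eq_left h.le]

theorem slot_mod_div (n : ℕ) {t : ℕ} (h : t % n < t / n) : slot n (t % n) (t / n) = t := by
  rw [slot_of_lt n h, mul_comm]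
  exact Nat.div_add_mod t n

theorem slot_mod {n v w : ℕ} (hv : v < n) (h : v < w) : slot n v w % n = v := by
  rw [slot_of_lt n h, Nat.mul_add_mod', Nat.mod_eq_of_lt hv]

theorem slot_div {n v w : ℕ} (hv : v < n) (h : v < w) : slot n v w / n = w := by
  rw [slot_of_lt n h, mul_comm, Nat.mul_add_div (by omega), Nat.div_eq_of_lt hv, add_zero]

theorem slot_lt {n v w : ℕ} (hv : v < n) (hw : w < n) : slot n v w < n * n := by
  have h1 : max v w + 1 ≤ n := by omega
  have h2 : min v w < n := by omega
  have := Nat.mul_le_mul_right n h1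
  rw [slot]
  nlinarith

namespace Scheme

variable (P : Scheme)

/-- There is an edge to be colored in slot `t`. -/
def Active (t : ℕ) : Prop := t % P.n < t / P.n ∧ P.graph.Adj (t % P.n) (t / P.n)

/-- The unnormalized probability of the color `c` in slot `t`, in the state `Z`. -/
noncomputable def weight (t : ℕ) (Z : ℕ → ℕ → ℝ) (c : ℕ) : ℝ :=
  P.frac t c * (Z (t % P.n) c * Z (t / P.n) c)

/-- The total weight of the colors in slot `t`. -/
noncomputable def total (t : ℕ) (Z : ℕ → ℕ → ℝ) : ℝ := ∑ c ∈ Finset.range P.K, P.weight t Z c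

/-- The probability of the color `c` in slot `t`. -/
noncomputable def prob (t : ℕ) (Z : ℕ → ℕ → ℝ) (c : ℕ) : ℝ := P.weight t Z c / P.total t Z

open Classical in
/-- The new state after the edge in slot `t` has got the color `d`: a color is worth `0` at a vertex
where it is used, and otherwise the inverse of the probability of this. -/
noncomputable def update (t : ℕ) (Z : ℕ → ℕ → ℝ) (d : ℕ) : ℕ → ℕ → ℝ := fun v c =>
  if P.Active t ∧ (v = t % P.n ∨ v = t / P.n) then
    if c = d then 0 else Z v c / (1 - P.prob t Z c)
  else Z v c

/-- The edge between `v` and `w` exists and is not processed before slot `t`. -/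
def Pending (t v w : ℕ) : Prop := P.graph.Adj v w ∧ t ≤ slot P.n v w

open Classical in
/-- The new value in slot `t` of the fraction of the color `c` spent at `v`, weighted by the worth
of `c` at the other endpoints. -/
noncomputable def spend (t : ℕ) (Z Y : ℕ → ℕ → ℝ) : ℕ → ℕ → ℝ := fun v c =>
  Y v c + ∑ w ∈ Finset.range P.n, if P.Pending t v w ∧ ¬ P.Pending (t + 1) v w then
    P.frac (slot P.n v w) c * Z w c else 0

open Classical in
/-- The exponent that controls the expenditure of the color `c` at the vertex `v`. -/
noncomputable def vertexExp (lam : ℝ) (t : ℕ) (Z Y : ℕ → ℕ → ℝ) (v c : ℕ) : ℝ :=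
  lam * (Y v c - (1 - 3 / 800)) + ∑ w ∈ Finset.range P.n, if P.Pending t v w then
    lam * P.frac (slot P.n v w) c * Z w c + 128 * (lam * P.frac (slot P.n v w) c) ^ 2 *
      (4 * 400 ^ 2 - Z w c ^ 2) else 0

/-- The exponent that controls the total weight in slot `s`. -/
noncomputable def edgeExp (lam : ℝ) (s : ℕ) (Z : ℕ → ℕ → ℝ) : ℝ :=
  lam * (1 - 1 / 800) + ∑ c ∈ Finset.range P.K, (-(lam * P.weight s Z c) +
    128 * ((lam * P.frac s c) ^ 2 * (16 * 400 ^ 4) - (lam * P.weight s Z c) ^ 2))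

/-- The state `Z` is such that the step in slot `t` is well-behaved. -/
structure IsRegular (t : ℕ) (Z : ℕ → ℕ → ℝ) : Prop where
  nonneg : ∀ v < P.n, ∀ c < P.K, 0 ≤ Z v c
  le : ∀ v < P.n, ∀ c < P.K, Z v c ≤ 400
  le_total : P.Active t → 1 - 1 / 800 ≤ P.total t Z
  frac_nonneg : ∀ s c, 0 ≤ P.frac s c
  frac_le : ∀ s c, P.frac s c ≤ 1 / 400000

variable {P}

theorem div_lt_of_lt {t : ℕ} (h : t < P.n * P.n) : t / P.n < P.n := Nat.div_lt_of_lt_mul h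

theorem mod_lt_of_lt {t : ℕ} (h : t < P.n * P.n) : t % P.n < P.n :=
  Nat.mod_lt _ (Nat.pos_of_ne_zero fun h0 => by simp [h0] at h)

/-! ### The effect of one rounding step on the potential -/

section Step

variable {t : ℕ} {Z : ℕ → ℕ → ℝ}

theorem weight_bounds (hZ : P.IsRegular t Z) {s : ℕ} (hs : s < P.n * P.n)
    {c : ℕ} (hc : c < P.K) :
    0 ≤ P.weight s Z c ∧ P.weight s Z c ≤ P.frac s c * 160000 := by
  have h1 := hZ.nonneg _ (mod_lt_of_lt hs) c hc
  have h2 := hZ.nonneg _ (div_lt_of_lt hs) c hc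
  have h3 := hZ.le _ (mod_lt_of_lt hs) c hc
  have h4 := hZ.le _ (div_lt_of_lt hs) c hc
  have h5 := hZ.frac_nonneg s c
  refine ⟨mul_nonneg h5 (mul_nonneg h1 h2), ?_⟩
  calc P.frac s c * (Z (s % P.n) c * Z (s / P.n) c) ≤ P.frac s c * (400 * 400) := by gcongr
    _ ≤ P.frac s c * 160000 := by norm_num

/-- A weight is at most 160000/400000 = 2/5, while the total is at least 799/800. -/
theorem prob_bounds (ht : t < P.n * P.n) (hact : P.Active t) (hZ : P.IsRegular t Z) {c : ℕ}
    (hc : c < P.K) : 0 ≤ P.prob t Z c ∧ P.prob t Z c ≤ 1 / 2 := by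
  obtain ⟨h1, h2⟩ := weight_bounds hZ ht hc
  have h3 := hZ.le_total hact
  have h4 := hZ.frac_le t c
  refine ⟨div_nonneg h1 (by linarith), ?_⟩
  rw [prob, div_le_iff₀ (by linarith)]
  linarith

theorem sum_prob (hact : P.Active t) (hZ : P.IsRegular t Z) :
    ∑ c ∈ Finset.range P.K, P.prob t Z c = 1 := by
  have h3 := hZ.le_total hact
  simp only [prob]
  rw [← Finset.sum_div]
  exact div_self (by rw [total] at h3; linarith)

theorem update_of_mem (hact : P.Active t) {v : ℕ} (hv : v = t % P.n ∨ v = t / P.n) (d c : ℕ) :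
    P.update t Z d v c = if c = d then 0 else Z v c / (1 - P.prob t Z c) := by
  rw [update, if_pos ⟨hact, hv⟩]

theorem update_of_notMem {v : ℕ} (hv : ¬ (v = t % P.n ∨ v = t / P.n)) (d c : ℕ) :
    P.update t Z d v c = Z v c := by
  rw [update, if_neg fun h => hv h.2]

theorem update_of_not_active (hact : ¬ P.Active t) (d : ℕ) : P.update t Z d = Z := by
  ext v c
  rw [update, if_neg fun h => hact h.1]

theorem Pending.of_succ {v w : ℕ} (h : P.Pending (t + 1) v w) : P.Pending t v w :=
  ⟨h.1, by have := h.2; omega⟩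

/-- The change of a part `g` of an exponent in one step. -/
noncomputable def change (q g S : ℝ) (b : Prop) [Decidable b] : ℝ :=
  if b then -g + 128 * S else growth q g S

open Classical in
/-- The part of `vertexExp` at `v` that is due to `w`. -/
noncomputable def part (P : Scheme) (lam : ℝ) (t : ℕ) (Z : ℕ → ℕ → ℝ) (v c w : ℕ) : ℝ :=
  if P.Pending (t + 1) v w then lam * P.frac (slot P.n v w) c * Z w c else 0

/-- If the processed pair contains `v`, its linear term just moves from pending to spent, and its
nonnegative quadratic term is dropped. Among the pairs at `v` still pending, only those with an
endpoint of the processed edge change. -/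
theorem vertexExp_update_le {lam : ℝ} (ht : t < P.n * P.n) (hZ : P.IsRegular t Z)
    (Y : ℕ → ℕ → ℝ) {v c d : ℕ} (hc : c < P.K) (hact : P.Active t) :
    P.vertexExp lam (t + 1) (P.update t Z d) (P.spend t Z Y) v c ≤
      P.vertexExp lam t Z Y v c + (change (P.prob t Z c) (part P lam t Z v c (t % P.n))
        (part P lam t Z v c (t % P.n) ^ 2) (c = d) + change (P.prob t Z c)
          (part P lam t Z v c (t / P.n)) (part P lam t Z v c (t / P.n) ^ 2) (c = d)) := by
  classical
  have ha := mod_lt_of_lt ht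
  have hb := div_lt_of_lt ht
  have hab : t % P.n ≠ t / P.n := hact.1.ne
  have hq := (prob_bounds ht hact hZ hc).2
  have hq1 : 1 - P.prob t Z c ≠ 0 := by linarith
  set δ : ℕ → ℝ := fun w => change (P.prob t Z c) (part P lam t Z v c w)
    (part P lam t Z v c w ^ 2) (c = d) with hδ
  have hsum : δ (t % P.n) + δ (t / P.n) = ∑ w ∈ Finset.range P.n,
      ((if w = t % P.n then δ w else 0) + if w = t / P.n then δ w else 0) := by
    rw [Finset.sum_add_distrib, Finset.sum_ite_eq', Finset.sum_ite_eq',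
      if_pos (Finset.mem_range.2 ha), if_pos (Finset.mem_range.2 hb)]
  change _ ≤ _ + (δ (t % P.n) + δ (t / P.n))
  rw [hsum, vertexExp, vertexExp, spend, add_assoc, ← Finset.sum_add_distrib, add_sub_right_comm,
    mul_add, add_assoc, Finset.mul_sum, ← Finset.sum_add_distrib]
  refine add_le_add le_rfl (Finset.sum_le_sum fun w hw => ?_)
  have hw' := Finset.mem_range.1 hw
  by_cases h1 : P.Pending (t + 1) v w
  · have h2 := h1.of_succ
    have hp : part P lam t Z v c w = lam * P.frac (slot P.n v w) c * Z w c := if_pos h1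
    simp only [h1, h2, not_true_eq_false, and_false, if_false, if_true, mul_zero, zero_add]
    have hmem : (w = t % P.n ∨ w = t / P.n) →
        lam * P.frac (slot P.n v w) c * P.update t Z d w c +
          128 * (lam * P.frac (slot P.n v w) c) ^ 2 * (4 * 400 ^ 2 - P.update t Z d w c ^ 2) =
        lam * P.frac (slot P.n v w) c * Z w c +
          128 * (lam * P.frac (slot P.n v w) c) ^ 2 * (4 * 400 ^ 2 - Z w c ^ 2) + δ w := by
      intro hw
      simp only [hδ]
      rw [update_of_mem hact hw, hp, change]
      split_ifs
      · ring
      · rw [growth]; field_simp; ring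
    by_cases hwa : w = t % P.n
    · rw [hmem (Or.inl hwa), if_pos hwa, if_neg (by rw [hwa]; exact hab)]
      linarith
    · by_cases hwb : w = t / P.n
      · rw [hmem (Or.inr hwb), if_neg hwa, if_pos hwb]
        linarith
      · rw [if_neg hwa, if_neg hwb, update_of_notMem (by tauto)]
        linarith
  · have hp : part P lam t Z v c w = 0 := if_neg h1
    have hδ0 : δ w = 0 := by
      simp only [hδ, hp]
      rw [change]
      split_ifs <;> simp [growth]
    simp only [hδ0, h1, not_false_eq_true, and_true, if_false, ite_self, add_zero]
    split_ifs
    · have h3 := hZ.nonneg w hw' c hc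
      have h4 := hZ.le w hw' c hc
      have h5 : 0 ≤ 128 * (lam * P.frac (slot P.n v w) c) ^ 2 * (4 * 400 ^ 2 - Z w c ^ 2) :=
        mul_nonneg (by positivity) (by nlinarith)
      linarith
    · simp

theorem vertexExp_of_not_active {lam : ℝ} (hZ : P.IsRegular t Z)
    (Y : ℕ → ℕ → ℝ) {v c d : ℕ} (hc : c < P.K) (hact : ¬ P.Active t) :
    P.vertexExp lam (t + 1) (P.update t Z d) (P.spend t Z Y) v c ≤ P.vertexExp lam t Z Y v c := by
  classical
  rw [update_of_not_active hact, vertexExp, vertexExp, spend, add_sub_right_comm,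
    mul_add, add_assoc, Finset.mul_sum, ← Finset.sum_add_distrib]
  refine add_le_add le_rfl (Finset.sum_le_sum fun w hw => ?_)
  have hw' := Finset.mem_range.1 hw
  by_cases h1 : P.Pending (t + 1) v w
  · simp [h1, h1.of_succ]
  · simp only [h1, not_false_eq_true, and_true, if_false, add_zero]
    split_ifs
    · have h3 := hZ.nonneg w hw' c hc
      have h4 := hZ.le w hw' c hc
      have h5 : 0 ≤ 128 * (lam * P.frac (slot P.n v w) c) ^ 2 * (4 * 400 ^ 2 - Z w c ^ 2) :=
        mul_nonneg (by positivity) (by nlinarith)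
      linarith
    · simp

theorem change_add (q g₁ S₁ g₂ S₂ : ℝ) (b : Prop) [Decidable b] :
    change q g₁ S₁ b + change q g₂ S₂ b = change q (g₁ + g₂) (S₁ + S₂) b := by
  simp only [change, growth]
  split_ifs <;> ring

/-- The expected exponential of the change of the exponent at a vertex. -/
theorem sum_prob_mul_exp_change_le (ht : t < P.n * P.n) (hact : P.Active t)
    (hZ : P.IsRegular t Z) {c : ℕ} (hc : c < P.K) {G S : ℝ} (hG : G ^ 2 ≤ 2 * S)
    (hS : S ≤ 1 / 200000) :
    ∑ d ∈ Finset.range P.K, P.prob t Z d * Real.exp (change (P.prob t Z c) G S (c = d)) ≤ 1 := by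
  have hS0 : 0 ≤ S := by nlinarith [sq_nonneg G]
  -- Only the color `c` has a nonzero part here.
  have key := sum_mul_exp_le_one (s := Finset.range P.K) (q := P.prob t Z)
    (G := fun e => if e = c then G else 0) (S := fun e => if e = c then S else 0)
    (fun e he => (prob_bounds ht hact hZ (Finset.mem_range.1 he)).1)
    (fun e he => (prob_bounds ht hact hZ (Finset.mem_range.1 he)).2)
    (sum_prob hact hZ) (fun e _ => by split_ifs <;> simp [hG])
    (fun e _ => by split_ifs; exacts [hS, by norm_num])
  refine le_of_eq_of_le (Finset.sum_congr rfl fun d _ => ?_) key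
  have h1 : ∑ e ∈ Finset.range P.K, growth (P.prob t Z e) (if e = c then G else 0)
      (if e = c then S else 0) = growth (P.prob t Z c) G S := by
    rw [Finset.sum_eq_single c]
    · simp
    · intro e _ he; simp [he, growth]
    · simp [hc]
  rw [h1, change]
  by_cases hd : c = d
  · subst hd
    simp only [if_true]
    congr 2
    ring
  · have hd' : d ≠ c := fun h => hd h.symm
    simp [hd, hd', growth]

/-- `v` may be adjacent to both endpoints of the processed edge, so two parts a and b jump together.
The general step applies with G = a + b and S = a² + b², as G² ≤ 2S. -/
theorem sum_prob_mul_exp_vertexExp_le {lam : ℝ} (hlam : 0 ≤ lam)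
    (hlam' : ∀ s c, lam * P.frac s c ≤ 1 / 10 ^ 17) (ht : t < P.n * P.n) (hact : P.Active t)
    (hZ : P.IsRegular t Z) (Y : ℕ → ℕ → ℝ) {v c : ℕ} (hc : c < P.K) :
    ∑ d ∈ Finset.range P.K, P.prob t Z d *
      Real.exp (P.vertexExp lam (t + 1) (P.update t Z d) (P.spend t Z Y) v c) ≤
        Real.exp (P.vertexExp lam t Z Y v c) := by
  have hpart : ∀ w < P.n, 0 ≤ part P lam t Z v c w ∧ part P lam t Z v c w ≤ 1 / 10 ^ 14 := by
    intro w hw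
    rw [part]
    split_ifs
    · have h1 := hZ.nonneg w hw c hc
      have h2 := hZ.le w hw c hc
      have h3 := mul_nonneg hlam (hZ.frac_nonneg (slot P.n v w) c)
      refine ⟨mul_nonneg h3 h1, ?_⟩
      calc _ ≤ 1 / 10 ^ 17 * (400 : ℝ) := by gcongr; exact hlam' _ _
        _ ≤ _ := by norm_num
    · norm_num
  obtain ⟨ha0, ha1⟩ := hpart _ (mod_lt_of_lt ht)
  obtain ⟨hb0, hb1⟩ := hpart _ (div_lt_of_lt ht)
  set a := part P lam t Z v c (t % P.n) with ha
  set b := part P lam t Z v c (t / P.n) with hb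
  have key := sum_prob_mul_exp_change_le ht hact hZ hc (G := a + b) (S := a ^ 2 + b ^ 2)
    (by nlinarith [sq_nonneg (a - b)]) (by norm_num at ha1 hb1 ⊢; nlinarith)
  calc _ ≤ ∑ d ∈ Finset.range P.K, P.prob t Z d * (Real.exp (P.vertexExp lam t Z Y v c) *
        Real.exp (change (P.prob t Z c) (a + b) (a ^ 2 + b ^ 2) (c = d))) := by
        refine Finset.sum_le_sum fun d hd => ?_
        have h0 := (prob_bounds ht hact hZ (Finset.mem_range.1 hd)).1
        rw [← Real.exp_add, ← change_add]
        gcongr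
        exact vertexExp_update_le ht hZ Y hc hact
    _ = Real.exp (P.vertexExp lam t Z Y v c) * ∑ d ∈ Finset.range P.K, P.prob t Z d *
        Real.exp (change (P.prob t Z c) (a + b) (a ^ 2 + b ^ 2) (c = d)) := by
        rw [Finset.mul_sum]
        exact Finset.sum_congr rfl fun d _ => by ring
    _ ≤ _ := mul_le_of_le_one_right (Real.exp_pos _).le key

/-- How the weights in a later slot `s` change. -/
theorem weight_update (hact : P.Active t) {s : ℕ} (hs : P.Active s) (hst : s ≠ t) :
    (∀ d c, P.weight s (P.update t Z d) c = P.weight s Z c) ∨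
    (∀ d c, P.weight s (P.update t Z d) c =
      if c = d then 0 else P.weight s Z c / (1 - P.prob t Z c)) := by
  by_cases hi : s % P.n = t % P.n ∨ s % P.n = t / P.n
  · have hj : ¬ (s / P.n = t % P.n ∨ s / P.n = t / P.n) := by
      intro hj
      have h1 := hact.1
      have h2 := hs.1
      have h3 : s % P.n = t % P.n ∧ s / P.n = t / P.n := by omega
      apply hst
      rw [← slot_mod_div P.n h1, ← slot_mod_div P.n h2, h3.1, h3.2]
    right
    intro d c
    rw [weight, update_of_mem hact hi, update_of_notMem hj, weight]
    split_ifs <;> ring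
  · by_cases hj : s / P.n = t % P.n ∨ s / P.n = t / P.n
    · right
      intro d c
      rw [weight, update_of_mem hact hj, update_of_notMem hi, weight]
      split_ifs <;> ring
    · left
      intro d c
      rw [weight, update_of_notMem hi, update_of_notMem hj, weight]

/-- Distinct slots share at most one endpoint, so a weight is either unaffected or moves with the
state at one vertex. The parts are negated weights because the total must be bounded from below. -/
theorem sum_prob_mul_exp_edgeExp_le {lam : ℝ} (hlam : 0 ≤ lam)
    (hlam' : ∀ s c, lam * P.frac s c ≤ 1 / 10 ^ 17) (ht : t < P.n * P.n) (hact : P.Active t)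
    (hZ : P.IsRegular t Z) {s : ℕ} (hs : P.Active s) (hs' : s < P.n * P.n) (hst : s ≠ t) :
    ∑ d ∈ Finset.range P.K, P.prob t Z d * Real.exp (P.edgeExp lam s (P.update t Z d)) ≤
      Real.exp (P.edgeExp lam s Z) := by
  rcases weight_update (Z := Z) hact hs hst with hw | hw
  · simp only [edgeExp, hw]
    rw [← Finset.sum_mul, sum_prob hact hZ, one_mul]
  · set g : ℕ → ℝ := fun c => -(lam * P.weight s Z c) with hg
    have hgb : ∀ c < P.K, g c ^ 2 ≤ 1 / 200000 := by
      intro c hc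
      obtain ⟨h1, h2⟩ := weight_bounds hZ hs' hc
      have h3 : lam * P.weight s Z c ≤ 1 / 10 ^ 11 := by
        calc lam * P.weight s Z c ≤ lam * (P.frac s c * 160000) := by gcongr
          _ = lam * P.frac s c * 160000 := by ring
          _ ≤ 1 / 10 ^ 17 * 160000 := by gcongr; exact hlam' _ _
          _ ≤ _ := by norm_num
      have h4 := mul_nonneg hlam h1
      simp only [hg, neg_sq]
      norm_num at h3 ⊢
      nlinarith
    have key := sum_mul_exp_le_one (s := Finset.range P.K) (q := P.prob t Z)
      (G := g) (S := fun c => g c ^ 2)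
      (fun e he => (prob_bounds ht hact hZ (Finset.mem_range.1 he)).1)
      (fun e he => (prob_bounds ht hact hZ (Finset.mem_range.1 he)).2)
      (sum_prob hact hZ) (fun e _ => by nlinarith [sq_nonneg (g e)])
      (fun e he => hgb e (Finset.mem_range.1 he))
    have hE : ∀ d ∈ Finset.range P.K, P.edgeExp lam s (P.update t Z d) = P.edgeExp lam s Z +
        (∑ c ∈ Finset.range P.K, growth (P.prob t Z c) (g c) (g c ^ 2) -
          (growth (P.prob t Z d) (g d) (g d ^ 2) + g d - 128 * g d ^ 2)) := by
      intro d hd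
      rw [edgeExp, edgeExp, add_assoc]
      congr 1
      have : growth (P.prob t Z d) (g d) (g d ^ 2) + g d - 128 * g d ^ 2 =
          ∑ c ∈ Finset.range P.K, if c = d then
            growth (P.prob t Z c) (g c) (g c ^ 2) + g c - 128 * g c ^ 2 else 0 := by
        rw [Finset.sum_ite_eq', if_pos hd]
      rw [this, ← Finset.sum_sub_distrib, ← Finset.sum_add_distrib]
      refine Finset.sum_congr rfl fun c hc => ?_
      have hq := (prob_bounds ht hact hZ (Finset.mem_range.1 hc)).2
      have hq1 : 1 - P.prob t Z c ≠ 0 := by linarith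
      rw [hw]
      simp only [hg]
      split_ifs
      · ring
      · rw [growth]; field_simp; ring
    calc _ = Real.exp (P.edgeExp lam s Z) * ∑ d ∈ Finset.range P.K, P.prob t Z d *
          Real.exp (∑ c ∈ Finset.range P.K, growth (P.prob t Z c) (g c) (g c ^ 2) -
            (growth (P.prob t Z d) (g d) (g d ^ 2) + g d - 128 * g d ^ 2)) := by
          rw [Finset.mul_sum]
          refine Finset.sum_congr rfl fun d hd => ?_
          rw [hE d hd, Real.exp_add]
          ring
      _ ≤ _ := mul_le_of_le_one_right (Real.exp_pos _).le key

open Classical in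
/-- The potential: it bounds the probability of failure from slot `t` on. -/
noncomputable def potential (P : Scheme) (lam : ℝ) (t : ℕ) (Z Y : ℕ → ℕ → ℝ) : ℝ :=
  ∑ v ∈ Finset.range P.n, ∑ c ∈ Finset.range P.K, Real.exp (P.vertexExp lam t Z Y v c) +
    ∑ s ∈ (Finset.range (P.n * P.n)).filter fun s => P.Active s ∧ t ≤ s,
      Real.exp (P.edgeExp lam s Z)

theorem potential_nonneg (lam : ℝ) (t : ℕ) (Z Y : ℕ → ℕ → ℝ) : 0 ≤ potential P lam t Z Y := by
  unfold potential
  positivity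

/-- The potential is a supermartingale. -/
theorem sum_prob_mul_potential_le {lam : ℝ} (hlam : 0 ≤ lam)
    (hlam' : ∀ s c, lam * P.frac s c ≤ 1 / 10 ^ 17) (ht : t < P.n * P.n) (hact : P.Active t)
    (hZ : P.IsRegular t Z) (Y : ℕ → ℕ → ℝ) :
    ∑ d ∈ Finset.range P.K, P.prob t Z d *
      potential P lam (t + 1) (P.update t Z d) (P.spend t Z Y) ≤ potential P lam t Z Y := by
  classical
  simp only [potential, mul_add, Finset.mul_sum]
  rw [Finset.sum_add_distrib]
  refine add_le_add ?_ ?_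
  · rw [Finset.sum_comm]
    refine Finset.sum_le_sum fun v _ => ?_
    rw [Finset.sum_comm]
    exact Finset.sum_le_sum fun c hc =>
      sum_prob_mul_exp_vertexExp_le hlam hlam' ht hact hZ Y (Finset.mem_range.1 hc)
  · rw [Finset.sum_comm]
    -- The term of slot `t` itself is dropped.
    refine (Finset.sum_le_sum fun s hs => ?_).trans
      (Finset.sum_le_sum_of_subset_of_nonneg (fun s hs => ?_) fun _ _ _ => (Real.exp_pos _).le)
    · rw [Finset.mem_filter, Finset.mem_range] at hs
      exact sum_prob_mul_exp_edgeExp_le hlam hlam' ht hact hZ hs.2.1 hs.1 (by omega)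
    · rw [Finset.mem_filter] at hs ⊢
      exact ⟨hs.1, hs.2.1, by omega⟩

theorem potential_le_of_not_active {lam : ℝ} (hact : ¬ P.Active t)
    (hZ : P.IsRegular t Z) (Y : ℕ → ℕ → ℝ) (d : ℕ) :
    potential P lam (t + 1) (P.update t Z d) (P.spend t Z Y) ≤ potential P lam t Z Y := by
  classical
  refine add_le_add ?_ ?_
  · gcongr with v _ c hc
    exact vertexExp_of_not_active hZ Y (Finset.mem_range.1 hc) hact
  · rw [update_of_not_active hact]
    refine Finset.sum_le_sum_of_subset_of_nonneg (fun s hs => ?_) fun _ _ _ => (Real.exp_pos _).le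
    rw [Finset.mem_filter] at hs ⊢
    exact ⟨hs.1, hs.2.1, by omega⟩

end Step

end Scheme

end OnlineEdgeColoring

/-! ### Success keeps the state bounded; the initial potential is tiny -/

namespace OnlineEdgeColoring

namespace Scheme

/-- The state after the colors in the list `l` have been chosen, the last one being its head. -/
noncomputable def state (P : Scheme) : List ℕ → ℕ → ℕ → ℝ
  | [] => fun _ _ => 1
  | d :: l => P.update l.length (P.state l) d

/-- The expenditure after the colors in the list `l` have been chosen. -/
noncomputable def spent (P : Scheme) : List ℕ → ℕ → ℕ → ℝ
  | [] => fun _ _ => 0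
  | _ :: l => P.spend l.length (P.state l) (P.spent l)

/-- The fractional coloring is a fractional edge coloring, with some slack, and with small entries
in terms of `D`. -/
structure IsFeasible (P : Scheme) (D : ℝ) : Prop where
  le_bound : 400000 ≤ D
  frac_nonneg : ∀ s c, 0 ≤ P.frac s c
  frac_le : ∀ s c, P.frac s c ≤ 1 / D
  sum_frac : ∀ s < P.n * P.n, P.Active s → ∑ c ∈ Finset.range P.K, P.frac s c = 1
  load_le : ∀ v < P.n, ∀ c, (open Classical in ∑ w ∈ Finset.range P.n,
    if P.graph.Adj v w then P.frac (slot P.n v w) c else 0) ≤ 0.995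

open Classical in
/-- All controlled quantities are close to their initial values after the choices in `l`. -/
structure IsGood (P : Scheme) (l : List ℕ) : Prop where
  vertex_le : ∀ v < P.n, ∀ c < P.K, P.spent l v c + ∑ w ∈ Finset.range P.n,
    (if P.Pending l.length v w then P.frac (slot P.n v w) c * P.state l w c else 0) ≤ 1 - 3 / 800
  le_edge : ∀ s < P.n * P.n, P.Active s → l.length ≤ s → 1 - 1 / 800 ≤ P.total s (P.state l)

/-- The color `d` may be chosen after the choices in `l`. -/
def IsLegit (P : Scheme) (l : List ℕ) (d : ℕ) : Prop :=
  P.Active l.length → d < P.K ∧ 0 < P.weight l.length (P.state l) d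

/-- The choices in `l` were legitimate and kept all controlled quantities close to their initial
values. -/
def IsSuccess (P : Scheme) : List ℕ → Prop
  | [] => True
  | d :: l => P.IsSuccess l ∧ P.IsLegit l d ∧ P.IsGood (d :: l)

variable {P : Scheme} {D : ℝ}

theorem isGood_nil (hP : P.IsFeasible D) : P.IsGood [] := by
  classical
  refine ⟨fun v hv c _ => ?_, fun s hs hact _ => ?_⟩
  · have := hP.load_le v hv c
    simp only [spent, state, Pending, List.length_nil, zero_le, and_true, mul_one, zero_add]
    refine le_trans (le_of_eq ?_) (this.trans (by norm_num))
    exact Finset.sum_congr rfl fun w _ => by congr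
  · simp only [total, weight, state, mul_one, hP.sum_frac s hs hact]
    norm_num

theorem IsSuccess.isGood (hP : P.IsFeasible D) {l : List ℕ} (h : P.IsSuccess l) : P.IsGood l := by
  cases l with
  | nil => exact isGood_nil hP
  | cons d l => exact h.2.2

/-- The invariant satisfied by the state and the expenditure. -/
structure IsConsistent (P : Scheme) (l : List ℕ) : Prop where
  nonneg : ∀ v < P.n, ∀ c < P.K, 0 ≤ P.state l v c
  inv_le : ∀ v < P.n, ∀ c < P.K,
    P.state l v c = 0 ∨ 1 - P.spent l v c / (1 - 1 / 800) ≤ 1 / P.state l v c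

/-- The expenditure is at most 1 - 3/800, so a nonzero worth Z satisfies 1/Z ≥ 1 - (1 - 3/800)/(1 -
1/800) = 2/799, that is, Z ≤ 399.5. -/
theorem IsConsistent.isRegular (hP : P.IsFeasible D) {l : List ℕ} (h : P.IsConsistent l)
    (hg : P.IsGood l) (hl : l.length < P.n * P.n) : P.IsRegular l.length (P.state l) := by
  classical
  refine ⟨h.nonneg, fun v hv c hc => ?_, fun hact => hg.le_edge _ hl hact le_rfl, hP.frac_nonneg,
    fun s c => (hP.frac_le s c).trans ?_⟩
  · rcases h.inv_le v hv c hc with h0 | h1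
    · rw [h0]; norm_num
    · have h2 := hg.vertex_le v hv c hc
      have h3 : 0 ≤ ∑ w ∈ Finset.range P.n, (if P.Pending l.length v w then
          P.frac (slot P.n v w) c * P.state l w c else 0) := by
        refine Finset.sum_nonneg fun w hw => ?_
        split_ifs
        · exact mul_nonneg (hP.frac_nonneg _ _) (h.nonneg w (Finset.mem_range.1 hw) c hc)
        · exact le_rfl
      rcases (h.nonneg v hv c hc).eq_or_lt with h4 | h4
      · rw [← h4]; norm_num
      · have h5 : (2 : ℝ) / 799 ≤ 1 / P.state l v c := by
          refine le_trans ?_ h1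
          have : P.spent l v c / (1 - 1 / 800) ≤ (1 - 3 / 800) / (1 - 1 / 800) := by
            refine div_le_div_of_nonneg_right ?_ (by norm_num)
            linarith
          norm_num at this ⊢
          linarith
        rw [le_div_iff₀ h4] at h5
        linarith
  · exact one_div_le_one_div_of_le (by norm_num) hP.le_bound

theorem le_spend {t : ℕ} {Z Y : ℕ → ℕ → ℝ} (hZ : P.IsRegular t Z) {v c : ℕ} (hc : c < P.K) :
    Y v c ≤ P.spend t Z Y v c := by
  classical
  refine le_add_of_nonneg_right (Finset.sum_nonneg fun w hw => ?_)
  split_ifs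
  · exact mul_nonneg (hZ.frac_nonneg _ _) (hZ.nonneg w (Finset.mem_range.1 hw) c hc)
  · exact le_rfl

theorem add_le_spend {t : ℕ} {Z Y : ℕ → ℕ → ℝ} (hZ : P.IsRegular t Z) {v w c : ℕ} (hc : c < P.K)
    (hw : w < P.n) (hadj : P.graph.Adj v w) (ht : slot P.n v w = t) :
    Y v c + P.frac t c * Z w c ≤ P.spend t Z Y v c := by
  classical
  rw [spend]
  gcongr
  have h1 : P.Pending t v w ∧ ¬ P.Pending (t + 1) v w :=
    ⟨⟨hadj, ht.ge⟩, fun h => by have := h.2; omega⟩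
  refine le_trans (le_of_eq ?_) (Finset.single_le_sum (fun w' hw' => ?_) (Finset.mem_range.2 hw))
  · rw [if_pos h1, ht]
  · split_ifs
    · exact mul_nonneg (hZ.frac_nonneg _ _) (hZ.nonneg w' (Finset.mem_range.1 hw') c hc)
    · exact le_rfl

/-- A step at most doubles the worth. The bound 800 thus holds even right after the step at which
control is lost, and there keeps the compensators, with constants 4 * 400² = 800² and 16 * 400⁴ =
800⁴, nonnegative. -/
theorem update_bounds {t : ℕ} {Z : ℕ → ℕ → ℝ} (ht : t < P.n * P.n) (hZ : P.IsRegular t Z)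
    (d : ℕ) {v c : ℕ} (hv : v < P.n) (hc : c < P.K) :
    0 ≤ P.update t Z d v c ∧ P.update t Z d v c ≤ 800 := by
  have h1 := hZ.nonneg v hv c hc
  have h2 := hZ.le v hv c hc
  by_cases hact : P.Active t
  · obtain ⟨h3, h4⟩ := prob_bounds ht hact hZ hc
    rw [update]
    split_ifs
    · norm_num
    · refine ⟨div_nonneg h1 (by linarith), ?_⟩
      rw [div_le_iff₀ (by linarith)]
      linarith
    · constructor <;> linarith
  · rw [update_of_not_active hact]
    constructor <;> linarith

/-- The update of the worth of a color at an endpoint of the processed edge. -/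
theorem inv_update_le {t : ℕ} {Z Y : ℕ → ℕ → ℝ} (hZ : P.IsRegular t Z)
    (hact : P.Active t) {v w c d : ℕ} (hv : v < P.n) (hc : c < P.K) (hw : w < P.n)
    (hadj : P.graph.Adj v w) (hslot : slot P.n v w = t) (hmem : v = t % P.n ∨ v = t / P.n)
    (hweight : P.weight t Z c = P.frac t c * (Z v c * Z w c))
    (h : Z v c = 0 ∨ 1 - Y v c / (1 - 1 / 800) ≤ 1 / Z v c) :
    P.update t Z d v c = 0 ∨
      1 - P.spend t Z Y v c / (1 - 1 / 800) ≤ 1 / P.update t Z d v c := by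
  rw [update_of_mem hact hmem]
  split_ifs
  · exact Or.inl rfl
  · rcases h with h | h
    · left; rw [h, zero_div]
    · rcases (hZ.nonneg v hv c hc).eq_or_lt with h0 | h0
      · left; rw [← h0, zero_div]
      · right
        have htot := hZ.le_total hact
        have h1 := add_le_spend (Y := Y) hZ hc hw hadj hslot
        have h2 : 0 ≤ P.frac t c * Z w c := mul_nonneg (hZ.frac_nonneg _ _) (hZ.nonneg w hw c hc)
        have h3 : P.frac t c * Z w c / P.total t Z ≤ P.frac t c * Z w c / (1 - 1 / 800) := by
          gcongr
        have h4 : (Y v c + P.frac t c * Z w c) / (1 - 1 / 800) ≤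
            P.spend t Z Y v c / (1 - 1 / 800) := by
          gcongr
        -- Multiplying by 1 - q lowers 1/Z by exactly the amount newly spent, divided by the total.
        have h5 : 1 / (Z v c / (1 - P.prob t Z c)) =
            1 / Z v c - P.frac t c * Z w c / P.total t Z := by
          rw [prob, hweight, one_div_div]
          field_simp
        rw [h5]
        rw [add_div] at h4
        linarith

theorem isConsistent_nil : P.IsConsistent [] := by
  refine ⟨fun v _ c _ => ?_, fun v _ c _ => Or.inr ?_⟩ <;> simp [state, spent]

theorem IsConsistent.cons {l : List ℕ} (h : P.IsConsistent l) (hl : l.length < P.n * P.n)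
    (hZ : P.IsRegular l.length (P.state l)) (d : ℕ) : P.IsConsistent (d :: l) := by
  refine ⟨fun v hv c hc => (update_bounds hl hZ d hv hc).1, fun v hv c hc => ?_⟩
  have ih := h.inv_le v hv c hc
  simp only [state, spent]
  by_cases hact : P.Active l.length ∧ (v = l.length % P.n ∨ v = l.length / P.n)
  · obtain ⟨hact, hmem⟩ := hact
    have hs := slot_mod_div P.n hact.1
    rcases hmem with h1 | h1
    · refine inv_update_le hZ hact hv hc (div_lt_of_lt hl) ?_ ?_ (Or.inl h1) ?_ ih
      · rw [h1]; exact hact.2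
      · rw [h1]; exact hs
      · rw [h1, weight]
    · refine inv_update_le hZ hact hv hc (mod_lt_of_lt hl) ?_ ?_ (Or.inr h1) ?_ ih
      · rw [h1]; exact hact.2.symm
      · rw [h1, slot_comm]; exact hs
      · rw [h1, weight]; ring
  · have h1 : P.update l.length (P.state l) d v c = P.state l v c := by
      rw [update, if_neg hact]
    rw [h1]
    refine ih.imp_right fun ih => le_trans ?_ ih
    have := le_spend (Y := P.spent l) hZ (v := v) hc
    gcongr

theorem IsSuccess.isConsistent (hP : P.IsFeasible D) {l : List ℕ} (h : P.IsSuccess l)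
    (hl : l.length ≤ P.n * P.n) : P.IsConsistent l := by
  induction l with
  | nil => exact isConsistent_nil
  | cons d l ih =>
    have hl' : l.length < P.n * P.n := by simpa using hl
    have := ih h.1 hl'.le
    exact this.cons hl' (this.isRegular hP (h.1.isGood hP) hl') d

theorem IsSuccess.isRegular (hP : P.IsFeasible D) {l : List ℕ} (h : P.IsSuccess l)
    (hl : l.length < P.n * P.n) : P.IsRegular l.length (P.state l) :=
  (h.isConsistent hP hl.le).isRegular hP (h.isGood hP) hl

/-- The potential is at least `1` when success ends. -/
theorem one_le_potential (hP : P.IsFeasible D) {lam : ℝ} (hlam : 0 ≤ lam) {l : List ℕ} {d : ℕ}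
    (h : P.IsSuccess l) (hl : l.length < P.n * P.n) (hbad : ¬ P.IsGood (d :: l)) :
    1 ≤ potential P lam (d :: l).length (P.state (d :: l)) (P.spent (d :: l)) := by
  classical
  have hreg := h.isRegular hP hl
  have hb : ∀ v < P.n, ∀ c < P.K, 0 ≤ P.state (d :: l) v c ∧ P.state (d :: l) v c ≤ 800 :=
    fun v hv c hc => update_bounds hl hreg d hv hc
  by_contra hlt
  push Not at hlt
  refine hbad ⟨fun v hv c hc => ?_, fun s hs hact hls => ?_⟩
  · by_contra hgt
    push Not at hgt
    refine hlt.not_ge ?_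
    -- Without its nonnegative quadratic terms, the exponent is `lam` times the amount by which the
    -- bound is violated.
    have h1 : 0 ≤ P.vertexExp lam (d :: l).length (P.state (d :: l)) (P.spent (d :: l)) v c := by
      rw [vertexExp]
      have h2 : lam * ∑ w ∈ Finset.range P.n, (if P.Pending (d :: l).length v w then
          P.frac (slot P.n v w) c * P.state (d :: l) w c else 0) ≤
          ∑ w ∈ Finset.range P.n, if P.Pending (d :: l).length v w then
            lam * P.frac (slot P.n v w) c * P.state (d :: l) w c +
              128 * (lam * P.frac (slot P.n v w) c) ^ 2 *
                (4 * 400 ^ 2 - P.state (d :: l) w c ^ 2) else 0 := by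
        rw [Finset.mul_sum]
        refine Finset.sum_le_sum fun w hw => ?_
        split_ifs
        · obtain ⟨h3, h4⟩ := hb w (Finset.mem_range.1 hw) c hc
          have : 0 ≤ 128 * (lam * P.frac (slot P.n v w) c) ^ 2 *
                (4 * 400 ^ 2 - P.state (d :: l) w c ^ 2) :=
            mul_nonneg (by positivity) (by nlinarith)
          linarith
        · simp
      have h3 := mul_nonneg hlam (sub_nonneg.2 hgt.le)
      rw [add_sub_right_comm, mul_add] at h3
      exact h3.trans (add_le_add le_rfl h2)
    calc (1 : ℝ) ≤ Real.exp (P.vertexExp lam (d :: l).length (P.state (d :: l))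
          (P.spent (d :: l)) v c) := Real.one_le_exp h1
      _ ≤ ∑ c ∈ Finset.range P.K, Real.exp (P.vertexExp lam (d :: l).length (P.state (d :: l))
          (P.spent (d :: l)) v c) :=
        Finset.single_le_sum (f := fun c => Real.exp (P.vertexExp lam (d :: l).length
          (P.state (d :: l)) (P.spent (d :: l)) v c)) (fun _ _ => (Real.exp_pos _).le)
          (Finset.mem_range.2 hc)
      _ ≤ ∑ v ∈ Finset.range P.n, ∑ c ∈ Finset.range P.K, Real.exp (P.vertexExp lam
          (d :: l).length (P.state (d :: l)) (P.spent (d :: l)) v c) :=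
        Finset.single_le_sum (f := fun v => ∑ c ∈ Finset.range P.K, Real.exp (P.vertexExp lam
          (d :: l).length (P.state (d :: l)) (P.spent (d :: l)) v c))
          (fun _ _ => Finset.sum_nonneg fun _ _ => (Real.exp_pos _).le) (Finset.mem_range.2 hv)
      _ ≤ _ := le_add_of_nonneg_right (Finset.sum_nonneg fun _ _ => (Real.exp_pos _).le)
  · by_contra hgt
    push Not at hgt
    refine hlt.not_ge ?_
    have h1 : 0 ≤ P.edgeExp lam s (P.state (d :: l)) := by
      have h2 : -(lam * P.total s (P.state (d :: l))) ≤ ∑ c ∈ Finset.range P.K,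
          (-(lam * P.weight s (P.state (d :: l)) c) + 128 * ((lam * P.frac s c) ^ 2 *
            (16 * 400 ^ 4) - (lam * P.weight s (P.state (d :: l)) c) ^ 2)) := by
        rw [total, Finset.mul_sum, ← Finset.sum_neg_distrib]
        refine Finset.sum_le_sum fun c hc => le_add_of_nonneg_right ?_
        obtain ⟨h3, h4⟩ := hb _ (mod_lt_of_lt hs) c (Finset.mem_range.1 hc)
        obtain ⟨h5, h6⟩ := hb _ (div_lt_of_lt hs) c (Finset.mem_range.1 hc)
        have h7 : P.state (d :: l) (s % P.n) c * P.state (d :: l) (s / P.n) c ≤ 800 * 800 := by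
          gcongr
        have h8 := mul_nonneg h3 h5
        have h9 : (lam * P.weight s (P.state (d :: l)) c) ^ 2 = (lam * P.frac s c) ^ 2 *
            (P.state (d :: l) (s % P.n) c * P.state (d :: l) (s / P.n) c) ^ 2 := by
          rw [weight]; ring
        rw [h9, ← mul_sub]
        refine mul_nonneg (by norm_num) (mul_nonneg (sq_nonneg _) ?_)
        nlinarith
      have h3 := mul_nonneg hlam (sub_nonneg.2 hgt.le)
      rw [edgeExp]
      rw [mul_sub, sub_eq_add_neg] at h3
      exact h3.trans (add_le_add le_rfl h2)
    calc (1 : ℝ) ≤ Real.exp (P.edgeExp lam s (P.state (d :: l))) := Real.one_le_exp h1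
      _ ≤ ∑ s ∈ (Finset.range (P.n * P.n)).filter fun s => P.Active s ∧ (d :: l).length ≤ s,
          Real.exp (P.edgeExp lam s (P.state (d :: l))) :=
        Finset.single_le_sum (f := fun s => Real.exp (P.edgeExp lam s (P.state (d :: l))))
          (fun _ _ => (Real.exp_pos _).le)
          (Finset.mem_filter.2 ⟨Finset.mem_range.2 hs, hact, hls⟩)
      _ ≤ _ := le_add_of_nonneg_left (Finset.sum_nonneg fun _ _ =>
          Finset.sum_nonneg fun _ _ => (Real.exp_pos _).le)

/-- With entries at most 1/D and sum at most 1, the squares sum to at most 1/D; this controls the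
initial compensators. -/
theorem sum_sq_le (hP : P.IsFeasible D) {ι : Type*} (s : Finset ι) {f : ι → ℝ}
    (h0 : ∀ i ∈ s, 0 ≤ f i) (h1 : ∀ i ∈ s, f i ≤ 1 / D) (hs : ∑ i ∈ s, f i ≤ 1) :
    ∑ i ∈ s, (D / 10 ^ 17 * f i) ^ 2 ≤ D / 10 ^ 34 := by
  have hD : 0 < D := by linarith [hP.le_bound]
  calc ∑ i ∈ s, (D / 10 ^ 17 * f i) ^ 2 ≤ ∑ i ∈ s, D / 10 ^ 34 * f i := by
        refine Finset.sum_le_sum fun i hi => ?_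
        have h2 : D * f i ≤ 1 := by
          have := h1 i hi
          rw [le_div_iff₀ hD] at this
          linarith
        have h3 : (D / 10 ^ 17 * f i) ^ 2 = D / 10 ^ 34 * f i * (D * f i) := by ring
        rw [h3]
        exact mul_le_of_le_one_right (mul_nonneg (by positivity) (h0 i hi)) h2
    _ = D / 10 ^ 34 * ∑ i ∈ s, f i := by rw [Finset.mul_sum]
    _ ≤ D / 10 ^ 34 := mul_le_of_le_one_right (by positivity) hs

/-- The initial value of the potential is exponentially small. -/
theorem potential_nil_le (hP : P.IsFeasible D) :
    potential P (D / 10 ^ 17) 0 (P.state []) (P.spent []) ≤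
      (P.n * P.K + P.n * P.n) * Real.exp (-(D / 10 ^ 21)) := by
  classical
  have hD : 0 < D := by linarith [hP.le_bound]
  have hv : ∀ v < P.n, ∀ c,
      P.vertexExp (D / 10 ^ 17) 0 (P.state []) (P.spent []) v c ≤ -(D / 10 ^ 21) := by
    intro v hv c
    set f : ℕ → ℝ := fun w => if P.graph.Adj v w then P.frac (slot P.n v w) c else 0 with hf
    have hf0 : ∀ w ∈ Finset.range P.n, 0 ≤ f w := fun w _ => by
      simp only [hf]; split_ifs
      exacts [hP.frac_nonneg _ _, le_rfl]
    have hf1 : ∀ w ∈ Finset.range P.n, f w ≤ 1 / D := fun w _ => by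
      simp only [hf]; split_ifs
      exacts [hP.frac_le _ _, by positivity]
    have hload : ∑ w ∈ Finset.range P.n, f w ≤ 0.995 := by
      refine le_trans (le_of_eq ?_) (hP.load_le v hv c)
      exact Finset.sum_congr rfl fun w _ => by simp only [hf]
    have hsq := sum_sq_le hP _ hf0 hf1 (hload.trans (by norm_num))
    have hE : P.vertexExp (D / 10 ^ 17) 0 (P.state []) (P.spent []) v c =
        D / 10 ^ 17 * (0 - (1 - 3 / 800)) + (D / 10 ^ 17 * ∑ w ∈ Finset.range P.n, f w +
          128 * (4 * 400 ^ 2 - 1) * ∑ w ∈ Finset.range P.n, (D / 10 ^ 17 * f w) ^ 2) := by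
      rw [vertexExp, Finset.mul_sum, Finset.mul_sum, ← Finset.sum_add_distrib]
      congr 1
      refine Finset.sum_congr rfl fun w _ => ?_
      simp only [Pending, zero_le, and_true, hf, state]
      split_ifs <;> ring
    rw [hE]
    -- The slack (1 - 3/800) - 0.995 = 1/800, times D/10^17, dominates the compensator.
    have := mul_le_mul_of_nonneg_left hload (by positivity : 0 ≤ D / 10 ^ 17)
    linarith
  have he : ∀ s < P.n * P.n, P.Active s →
      P.edgeExp (D / 10 ^ 17) s (P.state []) ≤ -(D / 10 ^ 21) := by
    intro s hs hact
    have h1 := hP.sum_frac s hs hact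
    have hsq := sum_sq_le hP (Finset.range P.K) (f := P.frac s) (fun c _ => hP.frac_nonneg s c)
      (fun c _ => hP.frac_le s c) h1.le
    have hE : P.edgeExp (D / 10 ^ 17) s (P.state []) = D / 10 ^ 17 * (1 - 1 / 800) +
        (-(D / 10 ^ 17) * ∑ c ∈ Finset.range P.K, P.frac s c + 128 * (16 * 400 ^ 4 - 1) *
          ∑ c ∈ Finset.range P.K, (D / 10 ^ 17 * P.frac s c) ^ 2) := by
      rw [edgeExp, Finset.mul_sum, Finset.mul_sum, ← Finset.sum_add_distrib]
      congr 1
      refine Finset.sum_congr rfl fun w _ => ?_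
      simp only [weight, state]
      ring
    -- The slack is D/(800 * 10^17), and the compensator is below 128 * 800⁴ * D/10^34 < 5.3 *
    -- D/10^21. This is what forces `lam` to be as small as D/10^17.
    rw [hE, h1]
    linarith
  rw [potential, add_mul]
  refine add_le_add ?_ ?_
  · calc _ ≤ ∑ v ∈ Finset.range P.n, ∑ c ∈ Finset.range P.K, Real.exp (-(D / 10 ^ 21)) := by
          gcongr with v hv' c hc
          exact hv v (Finset.mem_range.1 hv') c
      _ = _ := by simp [mul_assoc]
  · calc _ ≤ ∑ s ∈ (Finset.range (P.n * P.n)).filter fun s => P.Active s ∧ 0 ≤ s,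
          Real.exp (-(D / 10 ^ 21)) := by
          refine Finset.sum_le_sum fun s hs => Real.exp_le_exp.2 ?_
          rw [Finset.mem_filter, Finset.mem_range] at hs
          exact he s hs.1 hs.2.1
      _ ≤ ∑ s ∈ Finset.range (P.n * P.n), Real.exp (-(D / 10 ^ 21)) :=
          Finset.sum_le_sum_of_subset_of_nonneg (Finset.filter_subset _ _)
            fun _ _ _ => (Real.exp_pos _).le
      _ = _ := by simp

end Scheme

end OnlineEdgeColoring

/-! ### The random process and its failure probability -/

namespace OnlineEdgeColoring

namespace Scheme

open Classical in
/-- The probability of failure, estimated after the choices in a list. -/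
noncomputable def risk (P : Scheme) (lam : ℝ) : List ℕ → ℝ
  | [] => potential P lam 0 (P.state []) (P.spent [])
  | d :: l => if P.IsSuccess l ∧ P.IsLegit l d then
      potential P lam (d :: l).length (P.state (d :: l)) (P.spent (d :: l)) else 1

variable {P : Scheme} {D : ℝ}

theorem IsSuccess.risk_eq {lam : ℝ} {l : List ℕ} (h : P.IsSuccess l) :
    P.risk lam l = potential P lam l.length (P.state l) (P.spent l) := by
  cases l with
  | nil => rfl
  | cons d l => exact if_pos ⟨h.1, h.2.1⟩

theorem risk_nonneg (lam : ℝ) (l : List ℕ) : 0 ≤ P.risk lam l := by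
  cases l with
  | nil => exact potential_nonneg _ _ _ _
  | cons d l =>
    rw [risk]
    split_ifs
    exacts [potential_nonneg _ _ _ _, zero_le_one]

/-- Either the latest choice broke a bound, so that some exponent is nonnegative, or the stopped
potential has been set to 1. -/
theorem one_le_risk (hP : P.IsFeasible D) {lam : ℝ} (hlam : 0 ≤ lam) {l : List ℕ}
    (hl : l.length ≤ P.n * P.n) (h : ¬ P.IsSuccess l) : 1 ≤ P.risk lam l := by
  cases l with
  | nil => exact absurd trivial h
  | cons d l =>
    rw [risk]
    split_ifs with h1
    · refine one_le_potential hP hlam h1.1 (by simpa using hl) fun hg => h ⟨h1.1, h1.2, hg⟩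
    · exact le_rfl

theorem risk_cons_of_not_isSuccess {lam : ℝ} {l : List ℕ} (h : ¬ P.IsSuccess l) (d : ℕ) :
    P.risk lam (d :: l) = 1 := if_neg fun h1 => h h1.1

theorem risk_cons_le_of_not_active {lam : ℝ} (hP : P.IsFeasible D) {l : List ℕ}
    (hl : l.length < P.n * P.n) (h : P.IsSuccess l) (hact : ¬ P.Active l.length) (d : ℕ) :
    P.risk lam (d :: l) ≤ P.risk lam l := by
  rw [h.risk_eq, risk, if_pos ⟨h, fun h1 => absurd h1 hact⟩]
  exact potential_le_of_not_active hact (h.isRegular hP hl) _ d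

/-- An illegitimate color has probability 0, so the value 1 assigned to it does not matter. -/
theorem sum_prob_mul_risk_le (hP : P.IsFeasible D) {l : List ℕ}
    (hl : l.length < P.n * P.n) (h : P.IsSuccess l) (hact : P.Active l.length) :
    ∑ d ∈ Finset.range P.K, P.prob l.length (P.state l) d * P.risk (D / 10 ^ 17) (d :: l) ≤
      P.risk (D / 10 ^ 17) l := by
  have hD : 0 < D := by linarith [hP.le_bound]
  have hZ := h.isRegular hP hl
  rw [h.risk_eq]
  refine le_trans (Finset.sum_le_sum fun d hd => ?_)
    (sum_prob_mul_potential_le (lam := D / 10 ^ 17) (by positivity) (fun s c => ?_) hl hact hZ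
      (P.spent l))
  · have hd := Finset.mem_range.1 hd
    by_cases hw : 0 < P.weight l.length (P.state l) d
    · rw [risk, if_pos ⟨h, fun _ => ⟨hd, hw⟩⟩]
      exact le_rfl
    · have : P.weight l.length (P.state l) d = 0 :=
        le_antisymm (not_lt.1 hw) (weight_bounds hZ hl hd).1
      simp [prob, this]
  · have h1 := hP.frac_le s c
    rw [le_div_iff₀ hD] at h1
    have h2 : D / 10 ^ 17 * P.frac s c = (P.frac s c * D) / 10 ^ 17 := by ring
    rw [h2]
    gcongr

/-- The distribution of the color chosen after the choices in `l`. -/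
noncomputable def colorLaw (P : Scheme) (l : List ℕ) : Measure ℕ :=
  ∑ c ∈ Finset.range P.K, ENNReal.ofReal (P.prob l.length (P.state l) c) • Measure.dirac c

/-- The default covers states after a failure, where the weights may all vanish and `colorLaw` need
not be a probability measure. -/
theorem exists_sampler (μ : Measure ℕ) : ∃ f : unitInterval → ℕ, Measurable f ∧
    (IsProbabilityMeasure μ → volume.map f = μ) := by
  by_cases h : IsProbabilityMeasure μ
  · obtain ⟨f, hf, hf'⟩ := μ.exists_measurable_map_eq
    exact ⟨f, hf, fun _ => hf'⟩
  · exact ⟨fun _ => 0, measurable_const, fun h' => absurd h' h⟩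

/-- A function of a uniformly random number that has the distribution `μ`. -/
noncomputable def sampler (μ : Measure ℕ) : unitInterval → ℕ := (exists_sampler μ).choose

/-- The color chosen after the choices in `l`, as a function of a uniformly random number. -/
noncomputable def sample (P : Scheme) (l : List ℕ) : unitInterval → ℕ :=
  sampler (P.colorLaw l)

theorem measurable_sample (P : Scheme) (l : List ℕ) : Measurable (P.sample l) := (exists_sampler (P.colorLaw l)).choose_spec.1

theorem map_sample (h : IsProbabilityMeasure (P.colorLaw l)) :
    volume.map (P.sample l) = P.colorLaw l :=
  (exists_sampler (P.colorLaw l)).choose_spec.2 h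

theorem isProbabilityMeasure_colorLaw (hP : P.IsFeasible D) {l : List ℕ}
    (hl : l.length < P.n * P.n) (h : P.IsSuccess l) (hact : P.Active l.length) :
    IsProbabilityMeasure (P.colorLaw l) := by
  have hZ := h.isRegular hP hl
  constructor
  rw [colorLaw, Measure.finsetSum_apply]
  simp only [Measure.smul_apply, measure_univ, smul_eq_mul, mul_one]
  rw [← ENNReal.ofReal_sum_of_nonneg, sum_prob hact hZ, ENNReal.ofReal_one]
  exact fun c hc => (prob_bounds hl hact hZ (Finset.mem_range.1 hc)).1

theorem lintegral_risk_sample_le (hP : P.IsFeasible D) {l : List ℕ} (hl : l.length < P.n * P.n) :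
    ∫⁻ u, ENNReal.ofReal (P.risk (D / 10 ^ 17) (P.sample l u :: l)) ≤
      ENNReal.ofReal (P.risk (D / 10 ^ 17) l) := by
  have hD : 0 < D := by linarith [hP.le_bound]
  by_cases h : P.IsSuccess l
  · by_cases hact : P.Active l.length
    · have hZ := h.isRegular hP hl
      have hprob := isProbabilityMeasure_colorLaw hP hl h hact
      have h1 : ∫⁻ u, ENNReal.ofReal (P.risk (D / 10 ^ 17) (P.sample l u :: l)) =
          ∫⁻ d, ENNReal.ofReal (P.risk (D / 10 ^ 17) (d :: l)) ∂(P.colorLaw l) := by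
        rw [← map_sample hprob, lintegral_map (measurable_of_countable _) (P.measurable_sample l)]
      rw [h1, colorLaw, lintegral_finsetSum_measure]
      simp only [lintegral_smul_measure, lintegral_dirac, smul_eq_mul]
      refine le_trans (le_of_eq ?_) (ENNReal.ofReal_le_ofReal (sum_prob_mul_risk_le hP hl h hact))
      rw [ENNReal.ofReal_sum_of_nonneg]
      · refine Finset.sum_congr rfl fun c hc => ?_
        rw [ENNReal.ofReal_mul (prob_bounds hl hact hZ (Finset.mem_range.1 hc)).1]
      · exact fun c hc => mul_nonneg (prob_bounds hl hact hZ (Finset.mem_range.1 hc)).1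
          (risk_nonneg _ _)
    · calc _ ≤ ∫⁻ _ : unitInterval, ENNReal.ofReal (P.risk (D / 10 ^ 17) l) :=
            lintegral_mono fun u => ENNReal.ofReal_le_ofReal
              (risk_cons_le_of_not_active hP hl h hact _)
        _ = _ := by simp
  · calc _ ≤ ∫⁻ _ : unitInterval, ENNReal.ofReal (P.risk (D / 10 ^ 17) l) := by
          refine lintegral_mono fun u => ENNReal.ofReal_le_ofReal ?_
          rw [risk_cons_of_not_isSuccess h]
          exact one_le_risk hP (by positivity) hl.le h
      _ = _ := by simp

/-- The list of the colors chosen in the slots before `t`, the last one being its head. -/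
noncomputable def history (P : Scheme) (ω : ℕ → unitInterval) : ℕ → List ℕ
  | 0 => []
  | t + 1 => P.sample (P.history ω t) (ω t) :: P.history ω t

theorem length_history (ω : ℕ → unitInterval) (t : ℕ) : (P.history ω t).length = t := by
  induction t with
  | zero => rfl
  | succ t ih => simp [history, ih]

/-- The uniform distribution on sequences of numbers in the unit interval. -/
noncomputable def seedLaw : Measure (ℕ → unitInterval) :=
  Measure.infinitePi fun _ => (volume : Measure unitInterval)

instance isProbabilityMeasure_seedLaw : IsProbabilityMeasure seedLaw := by unfold seedLaw; infer_instance

theorem history_congr {ω ω' : ℕ → unitInterval} {t : ℕ} (h : ∀ s < t, ω s = ω' s) :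
    P.history ω t = P.history ω' t := by
  induction t with
  | zero => rfl
  | succ t ih => simp [history, ih fun s hs => h s (by omega), h t (by omega)]

instance instMeasurableSpaceList : MeasurableSpace (List ℕ) := ⊤

instance instDiscreteMeasurableSpaceList : DiscreteMeasurableSpace (List ℕ) := ⟨fun _ => trivial⟩

theorem measurable_history (t : ℕ) : Measurable fun ω => P.history ω t := by
  induction t with
  | zero => exact measurable_const
  | succ t ih =>
    have h1 : Measurable fun p : List ℕ × unitInterval => P.sample p.1 p.2 :: p.1 :=
      measurable_from_prod_countable_right fun l =>
        (measurable_of_countable (fun d : ℕ => d :: l)).comp (P.measurable_sample l)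
    have h2 : Measurable fun ω : ℕ → unitInterval => (P.history ω t, ω t) :=
      ih.prodMk (measurable_pi_apply t)
    have h3 := h1.comp h2
    simpa only [Function.comp_def, history] using h3

/-- The history before slot `t` is a function of the seeds with index below `t`. -/
theorem indepFun_history (t : ℕ) :
    ProbabilityTheory.IndepFun (fun ω => P.history ω t) (fun ω : ℕ → unitInterval => ω t)
      seedLaw := by
  have h1 : ProbabilityTheory.iIndepFun (fun (i : ℕ) (ω : ℕ → unitInterval) => ω i) seedLaw := by
    exact ProbabilityTheory.iIndepFun_infinitePi (X := fun _ u => u) fun _ => measurable_id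
  have h2 := h1.indepFun_finset (Finset.range t) {t} (by simp) fun i => measurable_pi_apply i
  set ext : (Finset.range t → unitInterval) → ℕ → unitInterval :=
    fun r s => if h : s ∈ Finset.range t then r ⟨s, h⟩ else 0 with hext
  have hextm : Measurable ext := by
    refine measurable_pi_lambda _ fun s => ?_
    simp only [hext]
    split_ifs
    · exact measurable_pi_apply _
    · exact measurable_const
  have h3 := h2.comp ((measurable_history (P := P) t).comp hextm)
    (measurable_pi_apply (⟨t, Finset.mem_singleton_self t⟩ : ({t} : Finset ℕ)))
  convert h3 using 1
  · ext ω : 1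
    refine history_congr fun s hs => ?_
    simp [hext, hs]
  · rfl

/-- By independence and Tonelli, the seed of slot `t` can be integrated out with the history fixed,
where the one-step bound applies. -/
theorem lintegral_risk_history_le (hP : P.IsFeasible D) {t : ℕ} (ht : t ≤ P.n * P.n) :
    ∫⁻ ω, ENNReal.ofReal (P.risk (D / 10 ^ 17) (P.history ω t)) ∂seedLaw ≤
      ENNReal.ofReal (P.risk (D / 10 ^ 17) []) := by
  induction t with
  | zero => simp [history]
  | succ t ih =>
    refine le_trans ?_ (ih (by omega))
    have hm : Measurable fun ω => P.history ω t := measurable_history t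
    have h1 : Measurable fun p : List ℕ × unitInterval =>
        ENNReal.ofReal (P.risk (D / 10 ^ 17) (P.sample p.1 p.2 :: p.1)) :=
      measurable_from_prod_countable_right fun l =>
        (measurable_of_countable fun d : ℕ =>
          ENNReal.ofReal (P.risk (D / 10 ^ 17) (d :: l))).comp (P.measurable_sample l)
    have hind := (ProbabilityTheory.indepFun_iff_map_prod_eq_prod_map_map hm.aemeasurable
      (measurable_pi_apply t).aemeasurable).1 (indepFun_history (P := P) t)
    have hmap : seedLaw.map (fun ω : ℕ → unitInterval => ω t) = volume :=
      (measurePreserving_eval_infinitePi (fun _ : ℕ => (volume : Measure unitInterval)) t).map_eq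
    rw [hmap] at hind
    calc ∫⁻ ω, ENNReal.ofReal (P.risk (D / 10 ^ 17) (P.history ω (t + 1))) ∂seedLaw
        = ∫⁻ p, ENNReal.ofReal (P.risk (D / 10 ^ 17) (P.sample p.1 p.2 :: p.1))
            ∂(seedLaw.map fun ω => (P.history ω t, ω t)) := by
          rw [lintegral_map h1 (hm.prodMk (measurable_pi_apply t))]
          rfl
      _ = ∫⁻ l, (∫⁻ u, ENNReal.ofReal (P.risk (D / 10 ^ 17) (P.sample l u :: l)))
            ∂(seedLaw.map fun ω => P.history ω t) := by
          rw [hind, lintegral_prod _ h1.aemeasurable]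
      _ = ∫⁻ ω, (∫⁻ u, ENNReal.ofReal (P.risk (D / 10 ^ 17)
            (P.sample (P.history ω t) u :: P.history ω t))) ∂seedLaw := by
          rw [lintegral_map (measurable_of_countable _) hm]
      _ ≤ _ := lintegral_mono fun ω => lintegral_risk_sample_le hP (by
          rw [length_history]; omega)

/-- Success is very likely. -/
theorem seedLaw_not_isSuccess_le (hP : P.IsFeasible D) :
    seedLaw {ω | ¬ P.IsSuccess (P.history ω (P.n * P.n))} ≤
      ENNReal.ofReal ((P.n * P.K + P.n * P.n) * Real.exp (-(D / 10 ^ 21))) := by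
  have hD : 0 < D := by linarith [hP.le_bound]
  have hm : Measurable fun ω => P.history ω (P.n * P.n) := measurable_history _
  calc seedLaw {ω | ¬ P.IsSuccess (P.history ω (P.n * P.n))}
      ≤ seedLaw {ω | 1 ≤ ENNReal.ofReal
          (P.risk (D / 10 ^ 17) (P.history ω (P.n * P.n)))} := by
        refine measure_mono fun ω hω => ?_
        have := one_le_risk hP (by positivity : 0 ≤ D / 10 ^ 17) (length_history ω _).le hω
        exact ENNReal.one_le_ofReal.2 this
    -- Markov's inequality.
    _ ≤ ∫⁻ ω, ENNReal.ofReal (P.risk (D / 10 ^ 17) (P.history ω (P.n * P.n))) ∂seedLaw := by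
        have := mul_meas_ge_le_lintegral (μ := seedLaw)
          ((measurable_of_countable fun l : List ℕ =>
            ENNReal.ofReal (P.risk (D / 10 ^ 17) l)).comp hm) 1
        simpa using this
    _ ≤ ENNReal.ofReal (P.risk (D / 10 ^ 17) []) := lintegral_risk_history_le hP le_rfl
    _ ≤ _ := ENNReal.ofReal_le_ofReal (potential_nil_le hP)

end Scheme

end OnlineEdgeColoring

/-! ### From the rounding process to an online algorithm -/

namespace OnlineEdgeColoring

theorem slot_endpoints {n v w : ℕ} (hv : v < n) (hw : w < n) (h : v ≠ w) :
    (slot n v w % n = v ∧ slot n v w / n = w) ∨ (slot n v w % n = w ∧ slot n v w / n = v) := by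
  rcases h.lt_or_gt with h | h
  · exact Or.inl ⟨slot_mod hv h, slot_div hv h⟩
  · rw [slot_comm]
    exact Or.inr ⟨slot_mod hw h, slot_div hw h⟩

theorem slot_injective {n v w w' : ℕ} (hv : v < n) (hw : w < n) (hw' : w' < n) (h : v ≠ w)
    (h' : v ≠ w') (heq : slot n v w = slot n v w') : w = w' := by
  rcases slot_endpoints hv hw h with ⟨h1, h2⟩ | ⟨h1, h2⟩ <;>
  rcases slot_endpoints hv hw' h' with ⟨h3, h4⟩ | ⟨h3, h4⟩ <;>
  rw [heq] at h1 h2 <;> omega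

namespace Scheme

variable {P Q : Scheme}

/-- The color given to the edge in slot `s`, an even number, or an odd number that belongs to the
slot alone in the case that the chosen color is already used at an endpoint. -/
noncomputable def slotColor (P : Scheme) (ω : ℕ → unitInterval) (s : ℕ) : ℕ :=
  open Classical in
  if 0 < P.weight s (P.state (P.history ω s)) (P.sample (P.history ω s) (ω s)) then
    2 * P.sample (P.history ω s) (ω s) else 2 * s + 1

theorem measurable_slotColor (P : Scheme) (s : ℕ) : Measurable fun ω => P.slotColor ω s := by
  classical
  have h1 : Measurable fun p : List ℕ × unitInterval =>
      if 0 < P.weight s (P.state p.1) (P.sample p.1 p.2) then 2 * P.sample p.1 p.2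
      else 2 * s + 1 :=
    measurable_from_prod_countable_right fun l =>
      (measurable_of_countable fun d : ℕ => if 0 < P.weight s (P.state l) d then 2 * d
        else 2 * s + 1).comp (P.measurable_sample l)
  have h2 : Measurable fun ω : ℕ → unitInterval => (P.history ω s, ω s) :=
    (measurable_history s).prodMk (measurable_pi_apply s)
  have h3 := h1.comp h2
  simp only [Function.comp_def] at h3
  convert h3 using 2
  rw [slotColor]

section Proper

theorem state_history_succ (ω : ℕ → unitInterval) (t : ℕ) : P.state (P.history ω (t + 1)) =
    P.update t (P.state (P.history ω t)) (P.sample (P.history ω t) (ω t)) := by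
  simp [history, state, length_history]

theorem state_eq_zero_of_sample {ω : ℕ → unitInterval} {s v : ℕ} (hact : P.Active s)
    (hv : v = s % P.n ∨ v = s / P.n) {t : ℕ} (ht : s < t) :
    P.state (P.history ω t) v (P.sample (P.history ω s) (ω s)) = 0 := by
  induction t, Nat.succ_le_of_lt ht using Nat.le_induction with
  | base => rw [Nat.succ_eq_add_one, state_history_succ, update_of_mem hact hv, if_pos rfl]
  | succ t h1 ih =>
    rw [state_history_succ, update, ih h1]
    split_ifs <;> simp

/-- A color drawn once is worth 0 at both endpoints ever after, so it has weight 0 in later slots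
there. Parity and the slot number separate the default colors. -/
theorem slotColor_ne_of_lt {ω : ℕ → unitInterval} {s t v : ℕ} (hs : P.Active s)
    (hvs : v = s % P.n ∨ v = s / P.n) (hvt : v = t % P.n ∨ v = t / P.n) (h : s < t) :
    P.slotColor ω s ≠ P.slotColor ω t := by
  rw [slotColor, slotColor]
  split_ifs with h1 h2 h2
  · intro heq
    have h3 := state_eq_zero_of_sample (ω := ω) hs hvs h
    rw [(by omega : P.sample (P.history ω s) (ω s) = P.sample (P.history ω t) (ω t))] at h3
    refine h2.ne' ?_
    rcases hvt with rfl | rfl <;> simp [weight, h3]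
  all_goals omega

theorem active_slot {v w : ℕ} (hv : v < P.n) (hw : w < P.n) (h : P.graph.Adj v w) :
    P.Active (slot P.n v w) := by
  rcases h.ne.lt_or_gt with h1 | h1
  · rw [Active, slot_mod hv h1, slot_div hv h1]
    exact ⟨h1, h⟩
  · rw [Active, slot_comm, slot_mod hw h1, slot_div hw h1]
    exact ⟨h1, h.symm⟩

/-- The coloring is always proper. -/
theorem slotColor_slot_ne (ω : ℕ → unitInterval) {v w w' : ℕ} (hv : v < P.n) (hw : w < P.n)
    (hw' : w' < P.n) (h : P.graph.Adj v w) (h' : P.graph.Adj v w') (hne : w ≠ w') :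
    P.slotColor ω (slot P.n v w) ≠ P.slotColor ω (slot P.n v w') := by
  have h1 : v = slot P.n v w % P.n ∨ v = slot P.n v w / P.n := by
    rcases slot_endpoints hv hw h.ne with h | h <;> omega
  have h2 : v = slot P.n v w' % P.n ∨ v = slot P.n v w' / P.n := by
    rcases slot_endpoints hv hw' h'.ne with h | h <;> omega
  have h3 : slot P.n v w ≠ slot P.n v w' := fun heq =>
    hne (slot_injective hv hw hw' h.ne h'.ne heq)
  rcases h3.lt_or_gt with h3 | h3
  · exact slotColor_ne_of_lt (active_slot hv hw h) h1 h2 h3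
  · exact (slotColor_ne_of_lt (active_slot hv hw' h') h2 h1 h3).symm

theorem isLegit_of_isSuccess {ω : ℕ → unitInterval} {s t : ℕ} (hst : s < t)
    (h : P.IsSuccess (P.history ω t)) :
    P.IsLegit (P.history ω s) (P.sample (P.history ω s) (ω s)) := by
  induction t with
  | zero => omega
  | succ t ih =>
    rcases (Nat.lt_succ_iff_lt_or_eq.1 hst) with h1 | rfl
    · exact ih h1 h.1
    · exact h.2.1

/-- After success, all edges get one of the colors of their fractional color vectors. -/
theorem exists_slotColor_eq {ω : ℕ → unitInterval} {s t : ℕ} (hst : s < t)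
    (h : P.IsSuccess (P.history ω t)) (hact : P.Active s) :
    ∃ c, P.frac s c ≠ 0 ∧ P.slotColor ω s = 2 * c := by
  have h1 := isLegit_of_isSuccess hst h
  rw [IsLegit, length_history] at h1
  refine ⟨_, fun h0 => (h1 hact).2.ne' ?_, if_pos (h1 hact).2⟩
  rw [weight, h0, zero_mul]

end Proper

/-! ### The color of a slot depends only on earlier data -/

section Locality

variable {m : ℕ}

/-- Two schemes that agree in the slots before `m`. -/
structure Agree (P Q : Scheme) (m : ℕ) : Prop where
  n_eq : P.n = Q.n
  K_eq : P.K = Q.K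
  active_iff : ∀ s < m, (P.Active s ↔ Q.Active s)
  frac_eq : ∀ s < m, P.frac s = Q.frac s

theorem Agree.weight_eq (h : P.Agree Q m) {s : ℕ} (hs : s < m) : P.weight s = Q.weight s := by
  ext Z c
  rw [weight, weight, h.frac_eq s hs, h.n_eq]

theorem Agree.prob_eq (h : P.Agree Q m) {s : ℕ} (hs : s < m) : P.prob s = Q.prob s := by
  ext Z c
  rw [prob, prob, total, total, h.weight_eq hs, h.K_eq]

theorem Agree.state_eq (h : P.Agree Q m) {l : List ℕ} (hl : l.length ≤ m) :
    P.state l = Q.state l := by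
  induction l with
  | nil => rfl
  | cons d l ih =>
    have hl' : l.length < m := hl
    ext v c
    simp only [state, update, ih hl'.le, h.prob_eq hl', h.n_eq, h.active_iff _ hl']
    rw [← h.n_eq]
    have h2 := h.active_iff _ hl'
    congr 1
    rw [h2]

/-- `sampler` is chosen as a function of the law alone, so equal laws give the same samples and not
just equally distributed ones. -/
theorem Agree.sample_eq (h : P.Agree Q m) {l : List ℕ} (hl : l.length < m) :
    P.sample l = Q.sample l := by
  have h1 : P.colorLaw l = Q.colorLaw l := by
    rw [colorLaw, colorLaw, h.K_eq, h.prob_eq hl, h.state_eq hl.le]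
  rw [sample, sample, h1]

theorem Agree.history_eq (h : P.Agree Q m) (ω : ℕ → unitInterval) {t : ℕ} (ht : t ≤ m) :
    P.history ω t = Q.history ω t := by
  induction t with
  | zero => rfl
  | succ t ih =>
    rw [history, history, ← ih (by omega), h.sample_eq (by rw [length_history]; omega)]

theorem Agree.slotColor_eq (h : P.Agree Q m) (ω : ℕ → unitInterval) {s : ℕ} (hs : s < m) :
    P.slotColor ω s = Q.slotColor ω s := by
  rw [slotColor, slotColor, ← h.history_eq ω hs.le, h.sample_eq (by rwa [length_history]),
    h.state_eq (by rw [length_history]; omega), h.weight_eq hs]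

end Locality

end Scheme

/-- The scheme that colors `g` on the vertices `0, …, n - 1`, with `D₀` a lower bound on the
maximum degree. -/
noncomputable def coloringScheme (n D₀ : ℕ) (g : SimpleGraph ℕ) : Scheme where
  n := n
  -- A number known in advance, so that schemes for different revealed graphs agree; the support of
  -- `frac` limits the colors really used.
  K := palette (max D₀ n)
  graph := g
  frac s := fracColor D₀ g (s % n) (s / n)

theorem degreeBound_le_max (n D₀ : ℕ) (g : SimpleGraph ℕ) {j : ℕ} (hj : j < n) :
    degreeBound D₀ g j ≤ max D₀ n := by
  classical
  refine max_le_max le_rfl (Finset.sup_le fun u _ => (Finset.card_filter_le _ _).trans ?_)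
  rw [Finset.card_range]
  exact hj

theorem isFeasible_coloringScheme {n D₀ : ℕ} (hD : 400000 ≤ D₀) (g : SimpleGraph ℕ) :
    (coloringScheme n D₀ g).IsFeasible D₀ := by
  classical
  have hD₀ : 0 < D₀ := by omega
  have hpos : ∀ j, 0 < degreeBound D₀ g j := fun j => hD₀.trans_le (le_degreeBound D₀ g j)
  refine ⟨by exact_mod_cast hD, fun s c => (isFairShare_share (hpos _) _).nonneg c,
    fun s c => ((isFairShare_share (hpos _) _).le c).trans ?_, fun s hs _ => ?_,
    fun v hv c => ?_⟩
  · exact one_div_le_one_div_of_le (by exact_mod_cast hD₀)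
      (by exact_mod_cast le_degreeBound D₀ g _)
  · have h1 := isFairShare_share (hpos (s / n)) (load D₀ g (s / n) (s % n))
    rw [← h1.sum_eq]
    refine (Finset.sum_subset (Finset.range_mono (palette_mono
      (degreeBound_le_max n D₀ g (Scheme.div_lt_of_lt hs)))) fun c _ hc => ?_).symm
    exact h1.eq_zero c (not_lt.1 fun h => hc (Finset.mem_range.2 h))
  · refine le_trans (le_of_eq ?_) (sum_fracColor_le hD₀ (g := g) n v c hv)
    rw [Finset.sum_filter]
    refine Finset.sum_congr rfl fun w hw => ?_
    have hw := Finset.mem_range.1 hw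
    change (if g.Adj v w then _ else _) = _
    split_ifs with hadj
    · change fracColor D₀ g (slot n v w % n) (slot n v w / n) c = _
      rcases hadj.ne.lt_or_gt with h | h
      · rw [slot_mod (show v < n from hv) h, slot_div (show v < n from hv) h, min_eq_left h.le, max_eq_right h.le]
      · rw [slot_comm, slot_mod hw h, slot_div hw h, min_eq_right h.le, max_eq_left h.le]
    · rfl

/-- The slots before `m * n` are those whose later vertex is below `m`. -/
theorem agree_coloringScheme (n D₀ : ℕ) {g h : SimpleGraph ℕ} {m : ℕ}
    (H : ∀ u < m, ∀ v < m, (g.Adj u v ↔ h.Adj u v)) :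
    (coloringScheme n D₀ g).Agree (coloringScheme n D₀ h) (m * n) := by
  have hdiv : ∀ s < m * n, s / n < m := fun s hs => Nat.div_lt_of_lt_mul (by rwa [mul_comm])
  refine ⟨rfl, rfl, fun s hs => and_congr_right fun h1 => ?_, fun s hs =>
    fracColor_congr H (hdiv s hs)⟩
  exact H _ (h1.trans (hdiv s hs)) _ (hdiv s hs)

/-- A graph on `0, …, n - 1`, as a graph on the natural numbers. -/
def onNat {n : ℕ} (G : SimpleGraph (Fin n)) : SimpleGraph ℕ := G.map Fin.valEmbedding

theorem onNat_adj {n : ℕ} {G : SimpleGraph (Fin n)} {u v : ℕ} :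
    (onNat G).Adj u v ↔ ∃ (hu : u < n) (hv : v < n), G.Adj ⟨u, hu⟩ ⟨v, hv⟩ := by
  simp only [onNat, SimpleGraph.map, Fin.valEmbedding_apply]
  constructor
  · rintro ⟨_, a, b, h, rfl, rfl⟩
    exact ⟨a.2, b.2, h⟩
  · rintro ⟨hu, hv, h⟩
    exact ⟨fun heq => h.ne (Fin.ext heq), _, _, h, rfl, rfl⟩

/-- The online edge-coloring algorithm for graphs with `n` vertices and maximum degree at least
`D₀`. -/
noncomputable def algorithm (n D₀ : ℕ) : Algorithm where
  Seed := ℕ → unitInterval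
  mSeed := inferInstance
  law := Scheme.seedLaw
  isProb := inferInstance
  color := fun ω t H i => (coloringScheme n D₀ (onNat H)).slotColor ω (slot n i t)
  measurable_color _ _ _ := Scheme.measurable_slotColor _ _

/-! ### The output of the algorithm on a given input -/

section Output

variable {V : Type*} {n D₀ : ℕ} {G : SimpleGraph V} {arrival : Fin n ≃ V}

/-- The scheme that the algorithm simulates. -/
noncomputable def inputScheme (D₀ : ℕ) (G : SimpleGraph V) (arrival : Fin n ≃ V) : Scheme :=
  coloringScheme n D₀ (onNat (G.comap arrival))

theorem color_revealed (ω : ℕ → unitInterval) {i j : Fin n} (h : i < j) :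
    (algorithm n D₀).color ω j (revealed G arrival j) ⟨i, h⟩ =
      (inputScheme D₀ G arrival).slotColor ω (slot n i j) := by
  refine (agree_coloringScheme n D₀ (m := j + 1) fun u hu v hv => ?_).slotColor_eq ω ?_
  · simp only [onNat_adj]
    exact ⟨fun ⟨_, _, h⟩ => ⟨by omega, by omega, h⟩, fun ⟨_, _, h⟩ => ⟨hu, hv, h⟩⟩
  · change slot n i j < _
    rw [slot_of_lt n (show (i : ℕ) < j from h), add_mul]
    have := i.2
    omega

theorem pairColor_algorithm (ω : ℕ → unitInterval) {i j : Fin n} (h : i ≠ j) :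
    (algorithm n D₀).pairColor ω G arrival i j =
      (inputScheme D₀ G arrival).slotColor ω (slot n i j) := by
  rcases h.lt_or_gt with h | h
  · exact (dif_pos h).trans (color_revealed ω h)
  · rw [slot_comm]
    exact (dif_neg h.not_gt).trans ((dif_pos h).trans (color_revealed ω h))

theorem output_algorithm (ω : ℕ → unitInterval) {u v : V} (h : G.Adj u v) :
    (algorithm n D₀).output ω G arrival ⟨s(u, v), h⟩ =
      (inputScheme D₀ G arrival).slotColor ω (slot n (arrival.symm u) (arrival.symm v)) :=
  pairColor_algorithm ω (arrival.symm.injective.ne h.ne)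

theorem adj_inputScheme {u v : V} (h : G.Adj u v) :
    (inputScheme D₀ G arrival).graph.Adj (arrival.symm u) (arrival.symm v) :=
  onNat_adj.2 ⟨(arrival.symm u).2, (arrival.symm v).2, by simpa using h⟩

theorem output_ne (ω : ℕ → unitInterval) (e f : G.edgeSet) (hne : e ≠ f)
    (h : ∃ v, v ∈ (e : Sym2 V) ∧ v ∈ (f : Sym2 V)) :
    (algorithm n D₀).output ω G arrival e ≠ (algorithm n D₀).output ω G arrival f := by
  obtain ⟨v, hv, hv'⟩ := h
  obtain ⟨e, he⟩ := e
  obtain ⟨f, hf⟩ := f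
  obtain ⟨w, rfl⟩ := Sym2.mem_iff_exists.1 hv
  obtain ⟨w', rfl⟩ := Sym2.mem_iff_exists.1 hv'
  rw [output_algorithm ω he, output_algorithm ω hf]
  refine Scheme.slotColor_slot_ne (P := inputScheme D₀ G arrival) ω (arrival.symm v).2
    (arrival.symm w).2 (arrival.symm w').2 (adj_inputScheme he) (adj_inputScheme hf) ?_
  rintro heq
  exact hne (Subtype.ext (congrArg (s(v, ·)) (arrival.symm.injective (Fin.ext heq))))

theorem degreeBound_le_maxDegree [Fintype V] [DecidableRel G.Adj] (h : D₀ ≤ G.maxDegree) (j : ℕ) :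
    degreeBound D₀ (onNat (G.comap arrival)) j ≤ G.maxDegree := by
  classical
  refine max_le h (Finset.sup_le fun u _ => ?_)
  by_cases hu : u < n
  · refine le_trans ?_ (G.degree_le_maxDegree (arrival ⟨u, hu⟩))
    rw [← SimpleGraph.card_neighborFinset_eq_degree]
    refine le_trans (Finset.card_le_card (t := (G.neighborFinset (arrival ⟨u, hu⟩)).image
      fun w => (arrival.symm w : ℕ)) fun i hi => ?_) Finset.card_image_le
    obtain ⟨_, hi', h1⟩ := onNat_adj.1 (Finset.mem_filter.1 hi).2
    exact Finset.mem_image.2 ⟨arrival ⟨i, hi'⟩, by simpa using h1, by simp⟩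
  · rw [degreeBelow, Finset.filter_false_of_mem fun i _ h1 => hu (onNat_adj.1 h1).1]
    simp

/-- After success every color lies in the support of a fractional color, hence in the palette of a
degree bound that never exceeds the true maximum degree. -/
theorem ncard_range_output_le_palette [Fintype V] [DecidableRel G.Adj] (hD₀ : 0 < D₀)
    (h : D₀ ≤ G.maxDegree) {ω : ℕ → unitInterval}
    (hω : (inputScheme D₀ G arrival).IsSuccess ((inputScheme D₀ G arrival).history ω (n * n))) :
    (Set.range ((algorithm n D₀).output ω G arrival)).ncard ≤ palette G.maxDegree := by
  have hsub : Set.range ((algorithm n D₀).output ω G arrival) ⊆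
      ((Finset.range (palette G.maxDegree)).image (2 * ·) : Finset ℕ) := by
    rintro _ ⟨⟨e, he⟩, rfl⟩
    induction e with | h u v =>
    rw [output_algorithm ω he]
    have hu := (arrival.symm u).2
    have hv := (arrival.symm v).2
    obtain ⟨c, hc, heq⟩ := Scheme.exists_slotColor_eq (slot_lt hu hv) hω
      (Scheme.active_slot (P := inputScheme D₀ G arrival) hu hv (adj_inputScheme he))
    rw [Finset.coe_image]
    refine ⟨c, ?_, heq.symm⟩
    by_contra hlt
    have hpos : 0 < degreeBound D₀ (onNat (G.comap arrival))
        (slot n (arrival.symm u) (arrival.symm v) / n) := hD₀.trans_le (le_degreeBound _ _ _)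
    refine hc ((isFairShare_share hpos _).eq_zero c ((palette_mono
      (degreeBound_le_maxDegree h _)).trans ?_))
    simpa using hlt
  calc _ ≤ ((Finset.range (palette G.maxDegree)).image (2 * ·)).card := by
        rw [← Set.ncard_coe_finset]
        exact Set.ncard_le_ncard hsub (Finset.finite_toSet _)
    _ ≤ _ := Finset.card_image_le.trans (Finset.card_range _).le

theorem ncard_range_le_card_mul_maxDegree [Fintype V] [DecidableRel G.Adj]
    (C : G.EdgeLabeling ℕ) : (Set.range C).ncard ≤ Fintype.card V * G.maxDegree := by
  classical
  have h1 : (Set.range C).ncard ≤ G.edgeFinset.card := by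
    rw [SimpleGraph.edgeFinset_card, ← Nat.card_eq_fintype_card]
    exact Finite.card_range_le C
  have h2 : ∑ v, G.degree v ≤ Fintype.card V * G.maxDegree := by
    refine (Finset.sum_le_card_nsmul _ _ _ fun v _ => G.degree_le_maxDegree v).trans ?_
    simp
  have h3 := G.sum_degrees_eq_twice_card_edges
  omega

theorem one_sub_le_law_real [Fintype V] [DecidableRel G.Adj] (hD₀ : 400000 ≤ D₀)
    (h : D₀ ≤ G.maxDegree) : 1 - (n * palette (max D₀ n) + n * n) * Real.exp (-(D₀ / 10 ^ 21)) ≤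
      (algorithm n D₀).law.real {ω | IsEdgeColoringWith ((algorithm n D₀).output ω G arrival)
        (1.777 * G.maxDegree)} := by
  set S := {ω | IsEdgeColoringWith ((algorithm n D₀).output ω G arrival) (1.777 * G.maxDegree)}
  set P := inputScheme D₀ G arrival
  set F := {ω | ¬ P.IsSuccess (P.history ω (n * n))}
  have hF : Scheme.seedLaw.real F ≤
      (n * palette (max D₀ n) + n * n) * Real.exp (-(D₀ / 10 ^ 21)) :=
    ENNReal.toReal_le_of_le_ofReal (by positivity)
      (Scheme.seedLaw_not_isSuccess_le (isFeasible_coloringScheme hD₀ _))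
  -- Covering the whole space, instead of taking complements, avoids measurability of `S`.
  have hcover : (Set.univ : Set (ℕ → unitInterval)) ⊆ S ∪ F := by
    intro ω _
    by_cases hω : P.IsSuccess (P.history ω (n * n))
    · refine Or.inl ⟨output_ne ω, ?_⟩
      have h1 : ((Set.range ((algorithm n D₀).output ω G arrival)).ncard : ℝ) ≤
          palette G.maxDegree := by
        exact_mod_cast ncard_range_output_le_palette (by omega) h hω
      have h2 : (400000 : ℝ) ≤ G.maxDegree := by exact_mod_cast hD₀.trans h
      -- The rounding of 1.776Δ up to an integer costs at most 1 ≤ 0.001Δ.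
      linarith [palette_le G.maxDegree]
    · exact Or.inr hω
  have h1 : 1 ≤ Scheme.seedLaw.real S + Scheme.seedLaw.real F :=
    calc 1 = Scheme.seedLaw.real Set.univ := by simp
      _ ≤ Scheme.seedLaw.real (S ∪ F) := measureReal_mono hcover
      _ ≤ _ := measureReal_union_le S F
  have h2 : (algorithm n D₀).law.real S = Scheme.seedLaw.real S := rfl
  linarith

end Output

/-- At most 3n² + n² events are controlled, each contributing at most n⁻⁴, and 4 ≤ n. -/
theorem failure_bound_le {n D₀ : ℕ} (hn : 4 ≤ n) (hD₀ : D₀ ≤ n)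
    (h : 4 * 10 ^ 21 * Real.log n ≤ D₀) :
    (n * palette (max D₀ n) + n * n) * Real.exp (-(D₀ / 10 ^ 21)) ≤ (n : ℝ) ^ (-1 : ℝ) := by
  have hn' : (4 : ℝ) ≤ n := by exact_mod_cast hn
  have h1 : Real.exp (-(D₀ / 10 ^ 21)) ≤ ((n : ℝ) ^ 4)⁻¹ := by
    rw [← Real.exp_log (by positivity : (0 : ℝ) < n ^ 4), ← Real.exp_neg, Real.log_pow]
    refine Real.exp_le_exp.2 (neg_le_neg ?_)
    rw [le_div_iff₀ (by positivity)]
    push_cast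
    linarith
  have h2 : (palette (max D₀ n) : ℝ) ≤ 3 * n := by
    rw [max_eq_right hD₀]
    linarith [palette_le n]
  calc _ ≤ (n * (3 * n) + n * n) * ((n : ℝ) ^ 4)⁻¹ := by gcongr
    _ = 4 / n * (n : ℝ)⁻¹ := by field_simp; ring
    _ ≤ 1 * (n : ℝ)⁻¹ := by
      gcongr
      rw [div_le_one (by positivity)]
      exact hn'
    _ = _ := by rw [Real.rpow_neg_one, one_mul]

end OnlineEdgeColoring

/-- There are an online algorithm, which knows the number `n` of vertices and a lower bound `Δ'` on
the maximum degree, and a constant `c > 0` such that, whenever `Δ' = ω(log n)`, the algorithm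
computes on every `n`-vertex graph of maximum degree `Δ ≥ Δ'`, revealed vertex by vertex in any
order, a `(1.777 + o(1)) Δ`-edge-coloring with probability at least `1 - n ^ (-c)`. -/
theorem mainTheorem8 :
    ∃ (A : ℕ → ℕ → OnlineEdgeColoring.Algorithm) (c : ℝ), 0 < c ∧
      ∀ Δ' : ℕ → ℕ, ((fun n : ℕ => Real.log n) =o[atTop] fun n : ℕ => (Δ' n : ℝ)) →
        ∃ ε : ℕ → ℝ, Tendsto ε atTop (𝓝 0) ∧
          ∀ (n : ℕ) (V : Type) [Fintype V] (G : SimpleGraph V) [DecidableRel G.Adj]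
            (arrival : Fin n ≃ V), Δ' n ≤ G.maxDegree →
              1 - (n : ℝ) ^ (-c) ≤
                (A n (Δ' n)).law.real {ω | OnlineEdgeColoring.IsEdgeColoringWith
                  ((A n (Δ' n)).output ω G arrival) ((1.777 + ε n) * G.maxDegree)} := by
  refine ⟨OnlineEdgeColoring.algorithm, 1, one_pos, fun Δ' hΔ => ?_⟩
  have hev : ∀ᶠ n : ℕ in atTop, 4 ≤ n ∧ 4 * 10 ^ 21 * Real.log n ≤ Δ' n ∧ 400000 ≤ Δ' n := by
    have h1 := hΔ.def (show (0 : ℝ) < 1 / (4 * 10 ^ 21) by norm_num)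
    have h2 := (Real.tendsto_log_atTop.comp tendsto_natCast_atTop_atTop).eventually_ge_atTop 1
    filter_upwards [eventually_ge_atTop 4, h1, h2] with n hn h1 h2
    simp only [Function.comp_apply] at h2
    rw [Real.norm_of_nonneg (by linarith), Real.norm_of_nonneg (by positivity)] at h1
    refine ⟨hn, by linarith, ?_⟩
    have h3 : ((400000 : ℕ) : ℝ) ≤ Δ' n := by push_cast; linarith
    exact_mod_cast h3
  obtain ⟨N, hN⟩ := eventually_atTop.1 hev
  -- For the finitely many small `n` the value `n` makes the claim trivial: there are at most nΔ
  -- edges, and the coloring is always proper.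
  refine ⟨fun n => if n < N then n else 0, tendsto_const_nhds.congr' ?_, ?_⟩
  · filter_upwards [eventually_ge_atTop N] with n hn
    rw [if_neg hn.not_gt]
  · intro n V _ G _ arrival hG
    have hcard : Fintype.card V = n := by
      rw [← Fintype.card_congr arrival, Fintype.card_fin]
    by_cases hn : n < N
    · simp only [if_pos hn]
      rw [Set.eq_univ_of_forall (s := {ω | OnlineEdgeColoring.IsEdgeColoringWith
        ((OnlineEdgeColoring.algorithm n (Δ' n)).output ω G arrival)
        ((1.777 + (n : ℝ)) * G.maxDegree)})]
      · rw [probReal_univ, sub_le_self_iff]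
        positivity
      · refine fun ω => ⟨OnlineEdgeColoring.output_ne ω, ?_⟩
        have h1 := OnlineEdgeColoring.ncard_range_le_card_mul_maxDegree
          ((OnlineEdgeColoring.algorithm n (Δ' n)).output ω G arrival)
        rw [hcard] at h1
        calc _ ≤ ((n * G.maxDegree : ℕ) : ℝ) := by exact_mod_cast h1
          _ = n * G.maxDegree := by push_cast; rfl
          _ ≤ _ := by gcongr; linarith
    · obtain ⟨h4, hlog, hbound⟩ := hN n (not_lt.1 hn)
      have : Nonempty V := ⟨arrival ⟨0, by omega⟩⟩
      -- The promise Δ' ≤ Δ < n bounds the palette size linearly in `n`.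
      have hlt : Δ' n ≤ n := hG.trans (hcard ▸ G.maxDegree_lt_card_verts.le)
      simp only [if_neg hn, add_zero]
      refine le_trans ?_ (OnlineEdgeColoring.one_sub_le_law_real hbound hG)
      linarith [OnlineEdgeColoring.failure_bound_le h4 hlt hlog]
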